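/- Let $k$ be a field of characteristic $0$, let $n\ge 0$, and let $X=\{1,x_1,\dots,x_n\}$ be a set of generators, each even or odd, with $1$ even, ordered by $1<x_1<\dots<x_n$. Let $D_X$ be the free nonassociative superalgebra over $k$ on $X$ with two multiplications $\cdot$ and $\{\,,\}$, and write $|a|$ for the parity of a homogeneous element $a$ and $D(a)=\{a,1\}$. Let $GenP=D_X/I$ be the free unital generalized Poisson superalgebra on $X$, where $I$ is the ideal generated by the elements $$\{a,b\}+(-1)^{|a||b|}\{b,a\},\quad a\cdot b-(-1)^{|a||b|}b\cdot a,\quad 1\cdot a-a,\quad (a\cdot b)\cdot c-a\cdot(b\cdot c),$$ $$\{a,b\}\cdot c+(-1)^{|a||b|}b\cdot\{a,c\}-D(a)\cdot b\cdot c-\{a,b\cdot c\},$$ $$\{\{a,b\},c\}+(-1)^{|a||b|}\{b,\{a,c\}\}-\{a,\{b,c\}\}$$ for all homogeneous $a,b,c\in D_X$. Good words are nonassociative words in $X$ with respect to the bracket, defined together with a linear order on them: every element of $X$ is a good word; a word $\{u,v\}$ is good if and only if $u,v$ are good, $u>v$, and $u_2\le v$ whenever $u=\{u_1,u_2\}$.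 The order may be any linear order on the good words that extends $1<x_1<\dots<x_n$ and satisfies $\{u,v\}>u$ and $\{u,v\}>v$ for every good word $\{u,v\}$. Let $M$ be the set of all good words together with all words $\{v,v\}$, where $v$ is an odd good word (the parity of a word is the sum of the parities of its letters). Order $M$ degree-lexicographically: words of larger degree (number of letters) are larger, letters are ordered by $1<x_1<\dots<x_n$, and for words of equal degree $\{u_1,u_2\}>\{v_1,v_2\}$ if $u_1>v_1$, or $u_1=v_1$ and $u_2>v_2$. Let $U$ consist of $1$ and of all products $e_{1}^{k_1}\cdots e_{m}^{k_m}$ in $GenP$, where $m\ge 1$, $e_1<\dots<e_m$ are elements of $M\setminus\{1\}$, $k_j\ge 1$, and $k_j=1$ whenever $e_j$ is odd. Then $U$ is a basis of the vector space $GenP$; that is, these products (including the empty product $1$) span $GenP$, and the family of them, indexed by the formal monomials, is linearly independent. -/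

import Mathlib

/-- Nonassociative words in the alphabet `X = {1, x_1, …, x_n}`: the letter `0` is the generator `1`
and the letter `i.succ` is `x_{i+1}`.  The product `u * v` of words stands for the bracket word
`{u, v}`. -/
abbrev LieWord (n : ℕ) : Type := FreeMagma (Fin (n + 1))

/-- The parity of a letter; `p i` is the parity of `x_{i+1}`, and the letter `1` is even. -/
def letterParity {n : ℕ} (p : Fin n → ZMod 2) : Fin (n + 1) → ZMod 2 := Fin.cons 0 p

namespace LieWord

/-- The parity of a word: the sum of the parities of its letters. -/
def parity {n : ℕ} (p : Fin n → ZMod 2) : LieWord n → ZMod 2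
  | .of x => letterParity p x
  | u * v => parity p u + parity p v

/-- Good words with respect to a relation `lt` on words.  All letters are good; `{u, v}` is good if
`u`, `v` are good, `u > v`, and `u₂ ≤ v` whenever `u = {u₁, u₂}`. -/
def IsGood {n : ℕ} (lt : LieWord n → LieWord n → Prop) : LieWord n → Prop
  | .of _ => True
  | u * v => IsGood lt u ∧ IsGood lt v ∧ lt v u ∧
      ∀ u₁ u₂ : LieWord n, u = u₁ * u₂ → u₂ = v ∨ lt u₂ v

/-- `lt` is an admissible order for the construction of good words: it is a strict linear order on
the good words, `1 < x_1 < ⋯ < x_n`, and every good word `{u, v}` is greater than `u` and `v`. -/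
structure IsAdmissibleOrder {n : ℕ} (lt : LieWord n → LieWord n → Prop) : Prop where
  irrefl : ∀ u, IsGood lt u → ¬ lt u u
  trans : ∀ u v w, IsGood lt u → IsGood lt v → IsGood lt w → lt u v → lt v w → lt u w
  total : ∀ u v, IsGood lt u → IsGood lt v → lt u v ∨ u = v ∨ lt v u
  letters : ∀ i j : Fin (n + 1), i < j → lt (FreeMagma.of i) (FreeMagma.of j)
  lt_mul : ∀ u v, IsGood lt (u * v) → lt u (u * v) ∧ lt v (u * v)

/-- The set `M`: good words, and the words `{v, v}` with `v` an odd good word. -/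
def shternSet {n : ℕ} (p : Fin n → ZMod 2) (lt : LieWord n → LieWord n → Prop) :
    Set (LieWord n) :=
  {w | IsGood lt w ∨ ∃ v, IsGood lt v ∧ parity p v = 1 ∧ w = v * v}

/-- The degree-lexicographic order on words (`FreeMagma.length` is the number of letters): words
are compared by degree first; two letters are compared by `1 < x_1 < ⋯ < x_n`, and two bracket words
`{u₁, u₂}`, `{v₁, v₂}` of the same degree first by `u₁`, `v₁` and then by `u₂`, `v₂`. -/
def DegLexLT {n : ℕ} : LieWord n → LieWord n → Prop
  | .of i, .of j => i < j
  | .of _, _ * _ => True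
  | _ * _, .of _ => False
  | u₁ * u₂, v₁ * v₂ => (u₁ * u₂).length < (v₁ * v₂).length ∨
      ((u₁ * u₂).length = (v₁ * v₂).length ∧ (DegLexLT u₁ v₁ ∨ (u₁ = v₁ ∧ DegLexLT u₂ v₂)))

end LieWord

/-- Nonassociative words in the alphabet `X = {1, x_1, …, x_n}` with two binary operations. -/
inductive DiWord (n : ℕ) : Type
  | of (x : Fin (n + 1)) : DiWord n
  | mul (u v : DiWord n) : DiWord n
  | br (u v : DiWord n) : DiWord n

/-- The parity of a word: the sum of the parities of its letters. -/
def DiWord.parity {n : ℕ} (p : Fin n → ZMod 2) : DiWord n → ZMod 2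
  | .of x => letterParity p x
  | .mul u v => u.parity p + v.parity p
  | .br u v => u.parity p + v.parity p

/-- The free nonassociative algebra `D_X` with two multiplications. -/
def FreeDialgebra (k : Type*) [Field k] (n : ℕ) : Type _ := DiWord n →₀ k

namespace FreeDialgebra

variable {k : Type*} [Field k] {n : ℕ}

noncomputable instance : AddCommGroup (FreeDialgebra k n) :=
  inferInstanceAs (AddCommGroup (DiWord n →₀ k))

noncomputable instance : Module k (FreeDialgebra k n) :=
  inferInstanceAs (Module k (DiWord n →₀ k))

/-- A word as an element of the free algebra. -/
noncomputable def word (w : DiWord n) : FreeDialgebra k n :=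
  (Finsupp.single w (1 : k) : DiWord n →₀ k)

/-- The bilinear extension of an operation on words. -/
noncomputable def extend (f : DiWord n → DiWord n → DiWord n) :
    FreeDialgebra k n →ₗ[k] FreeDialgebra k n →ₗ[k] FreeDialgebra k n :=
  Finsupp.linearCombination k
    (fun u => (Finsupp.linearCombination k (fun v => (word (f u v) : FreeDialgebra k n)) :
      (DiWord n →₀ k) →ₗ[k] FreeDialgebra k n))

/-- The first multiplication `a · b`, as a bilinear map. -/
noncomputable def mulHom : FreeDialgebra k n →ₗ[k] FreeDialgebra k n →ₗ[k] FreeDialgebra k n :=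
  extend DiWord.mul

/-- The second multiplication `{a, b}`, as a bilinear map. -/
noncomputable def brHom : FreeDialgebra k n →ₗ[k] FreeDialgebra k n →ₗ[k] FreeDialgebra k n :=
  extend DiWord.br

noncomputable instance : Mul (FreeDialgebra k n) := ⟨fun a b => mulHom a b⟩

noncomputable instance : Bracket (FreeDialgebra k n) (FreeDialgebra k n) := ⟨fun a b => brHom a b⟩

/-- The generator `1` of `D_X`. -/
noncomputable instance : One (FreeDialgebra k n) := ⟨word (DiWord.of 0)⟩

/-- The homogeneous component of parity `i`: the span of the words of parity `i`. -/
noncomputable def homogeneous (k : Type*) [Field k] {n : ℕ} (p : Fin n → ZMod 2) (i : ZMod 2) :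
    Submodule k (FreeDialgebra k n) :=
  Submodule.span k (word '' {w | w.parity p = i})

/-- The sign `(-1)^{|a||b|}` for homogeneous elements of parities `i` and `j`. -/
def sign (k : Type*) [Field k] (i j : ZMod 2) : k := (-1) ^ (i.val * j.val)

/-- The defining relations of unital generalized Poisson superalgebras, for homogeneous
`a`, `b`, `c` of parities `i`, `j`, `l`; here `⁅a, 1⁆` is `D(a)`. -/
inductive Relation (p : Fin n → ZMod 2) : FreeDialgebra k n → Prop
  | anticomm (i j : ZMod 2) (a b : FreeDialgebra k n)
      (ha : a ∈ homogeneous k p i) (hb : b ∈ homogeneous k p j) :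
      Relation p (⁅a, b⁆ + sign k i j • ⁅b, a⁆)
  | comm (i j : ZMod 2) (a b : FreeDialgebra k n)
      (ha : a ∈ homogeneous k p i) (hb : b ∈ homogeneous k p j) :
      Relation p (a * b - sign k i j • (b * a))
  | one_mul (i : ZMod 2) (a : FreeDialgebra k n) (ha : a ∈ homogeneous k p i) :
      Relation p (1 * a - a)
  | assoc (i j l : ZMod 2) (a b c : FreeDialgebra k n) (ha : a ∈ homogeneous k p i)
      (hb : b ∈ homogeneous k p j) (hc : c ∈ homogeneous k p l) :
      Relation p ((a * b) * c - a * (b * c))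
  | leibniz (i j l : ZMod 2) (a b c : FreeDialgebra k n) (ha : a ∈ homogeneous k p i)
      (hb : b ∈ homogeneous k p j) (hc : c ∈ homogeneous k p l) :
      Relation p (⁅a, b⁆ * c + sign k i j • (b * ⁅a, c⁆) - (⁅a, 1⁆ * b) * c - ⁅a, b * c⁆)
  | jacobi (i j l : ZMod 2) (a b c : FreeDialgebra k n) (ha : a ∈ homogeneous k p i)
      (hb : b ∈ homogeneous k p j) (hc : c ∈ homogeneous k p l) :
      Relation p (⁅⁅a, b⁆, c⁆ + sign k i j • ⁅b, ⁅a, c⁆⁆ - ⁅a, ⁅b, c⁆⁆)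

/-- The ideal `I` of `D_X` generated by the relations: the least subspace that contains them and is
closed under both multiplications, on either side, by arbitrary elements. -/
noncomputable def ideal (k : Type*) [Field k] {n : ℕ} (p : Fin n → ZMod 2) : Submodule k (FreeDialgebra k n) :=
  sInf {S | (∀ r, Relation p r → r ∈ S) ∧
    ∀ s ∈ S, ∀ d, d * s ∈ S ∧ s * d ∈ S ∧ ⁅d, s⁆ ∈ S ∧ ⁅s, d⁆ ∈ S}

theorem mem_ideal_of_relation {p : Fin n → ZMod 2} {r : FreeDialgebra k n} (h : Relation p r) :
    r ∈ ideal k p := by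
  rw [ideal, Submodule.mem_sInf]
  exact fun S hS => hS.1 r h

theorem ideal_closed {p : Fin n → ZMod 2} {s : FreeDialgebra k n} (h : s ∈ ideal k p)
    (d : FreeDialgebra k n) :
    d * s ∈ ideal k p ∧ s * d ∈ ideal k p ∧ ⁅d, s⁆ ∈ ideal k p ∧ ⁅s, d⁆ ∈ ideal k p := by
  simp only [ideal, Submodule.mem_sInf] at h ⊢
  exact ⟨fun S hS => (hS.2 s (h S hS) d).1, fun S hS => (hS.2 s (h S hS) d).2.1,
    fun S hS => (hS.2 s (h S hS) d).2.2.1, fun S hS => (hS.2 s (h S hS) d).2.2.2⟩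

theorem word_mem_homogeneous (p : Fin n → ZMod 2) (w : DiWord n) :
    (word w : FreeDialgebra k n) ∈ homogeneous k p (w.parity p) :=
  Submodule.subset_span ⟨w, rfl, rfl⟩

/-- A property of elements that holds for words and is closed under linear combinations holds for
all elements. -/
theorem induction_word {P : FreeDialgebra k n → Prop} (h0 : P 0) (hw : ∀ w, P (word w))
    (hadd : ∀ a b, P a → P b → P (a + b)) (hsmul : ∀ (t : k) a, P a → P (t • a)) (a) : P a := by
  refine Finsupp.induction_linear (motive := P) a h0 hadd ?_
  intro w t
  have e : (Finsupp.single w t : DiWord n →₀ k) = t • Finsupp.single w (1 : k) := by simp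
  rw [e]
  exact hsmul t _ (hw w)

end FreeDialgebra

/-- The free unital generalized Poisson superalgebra `GenP = D_X / I` on the generators
`1, x_1, …, x_n`, where `x_{i+1}` has parity `p i`. -/
def GenP (k : Type*) [Field k] {n : ℕ} (p : Fin n → ZMod 2) : Type _ :=
  FreeDialgebra k n ⧸ FreeDialgebra.ideal k p

namespace GenP

open FreeDialgebra

variable {k : Type*} [Field k] {n : ℕ} {p : Fin n → ZMod 2}

noncomputable instance : AddCommGroup (GenP k p) :=
  inferInstanceAs (AddCommGroup (FreeDialgebra k n ⧸ FreeDialgebra.ideal k p))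

noncomputable instance : Module k (GenP k p) :=
  inferInstanceAs (Module k (FreeDialgebra k n ⧸ FreeDialgebra.ideal k p))

/-- The quotient map `D_X → GenP`. -/
noncomputable def mk (k : Type*) [Field k] {n : ℕ} (p : Fin n → ZMod 2) :
    FreeDialgebra k n →ₗ[k] GenP k p := (FreeDialgebra.ideal k p).mkQ

theorem mk_surjective : Function.Surjective (mk k p) := Submodule.mkQ_surjective _

theorem mk_eq_mk {a b : FreeDialgebra k n} : mk k p a = mk k p b ↔ a - b ∈ ideal k p :=
  Submodule.Quotient.eq _

/-- The bilinear map on `GenP` induced by a bilinear map on `D_X` that respects the ideal. -/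
noncomputable def descend (f : FreeDialgebra k n →ₗ[k] FreeDialgebra k n →ₗ[k] FreeDialgebra k n)
    (hl : ∀ s ∈ ideal k p, ∀ d, f s d ∈ ideal k p) (hr : ∀ s ∈ ideal k p, ∀ d, f d s ∈ ideal k p) :
    GenP k p →ₗ[k] GenP k p →ₗ[k] GenP k p :=
  (ideal k p).liftQ
    (LinearMap.flip ((ideal k p).liftQ (LinearMap.flip (f.compr₂ (mk k p))) (by
      intro s hs
      rw [LinearMap.mem_ker]
      ext1 d
      exact (Submodule.Quotient.mk_eq_zero _).2 (hr s hs d)))) (by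
      intro s hs
      rw [LinearMap.mem_ker]
      ext1 d
      obtain ⟨d, rfl⟩ := mk_surjective d
      exact (Submodule.Quotient.mk_eq_zero _).2 (hl s hs d))

/-- The multiplication `a · b` of `GenP`, as a bilinear map. -/
noncomputable def mulHom (k : Type*) [Field k] {n : ℕ} (p : Fin n → ZMod 2) :
    GenP k p →ₗ[k] GenP k p →ₗ[k] GenP k p :=
  descend FreeDialgebra.mulHom (fun _ hs d => (ideal_closed hs d).2.1)
    (fun _ hs d => (ideal_closed hs d).1)

/-- The bracket `{a, b}` of `GenP`, as a bilinear map. -/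
noncomputable def brHom (k : Type*) [Field k] {n : ℕ} (p : Fin n → ZMod 2) :
    GenP k p →ₗ[k] GenP k p →ₗ[k] GenP k p :=
  descend FreeDialgebra.brHom (fun _ hs d => (ideal_closed hs d).2.2.2)
    (fun _ hs d => (ideal_closed hs d).2.2.1)

noncomputable instance : Mul (GenP k p) := ⟨fun a b => mulHom k p a b⟩

noncomputable instance : Bracket (GenP k p) (GenP k p) := ⟨fun a b => brHom k p a b⟩

noncomputable instance : One (GenP k p) := ⟨mk k p 1⟩

theorem mk_mul (a b : FreeDialgebra k n) : mk k p (a * b) = mk k p a * mk k p b := rfl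

theorem mk_br (a b : FreeDialgebra k n) : mk k p ⁅a, b⁆ = ⁅mk k p a, mk k p b⁆ := rfl

theorem mk_one : mk k p 1 = 1 := rfl

theorem add_mul' (a b c : GenP k p) : (a + b) * c = a * c + b * c :=
  LinearMap.map_add₂ (mulHom k p) a b c

theorem mul_add' (a b c : GenP k p) : a * (b + c) = a * b + a * c := map_add (mulHom k p a) b c

theorem smul_mul' (t : k) (a b : GenP k p) : (t • a) * b = t • (a * b) :=
  LinearMap.map_smul₂ (mulHom k p) t a b

theorem mul_smul' (t : k) (a b : GenP k p) : a * (t • b) = t • (a * b) :=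
  map_smul (mulHom k p a) t b

theorem zero_mul' (a : GenP k p) : 0 * a = 0 := LinearMap.map_zero₂ (mulHom k p) a

theorem mul_zero' (a : GenP k p) : a * 0 = 0 := map_zero (mulHom k p a)

theorem one_mul' (a : GenP k p) : 1 * a = a := by
  obtain ⟨a, rfl⟩ := mk_surjective a
  induction a using induction_word with
  | h0 => rw [map_zero, mul_zero']
  | hw w =>
    rw [← mk_one, ← mk_mul, mk_eq_mk]
    exact mem_ideal_of_relation (.one_mul _ _ (word_mem_homogeneous p w))
  | hadd a b ha hb => rw [map_add, mul_add', ha, hb]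
  | hsmul t a ha => rw [map_smul, mul_smul', ha]

theorem mul_one' (a : GenP k p) : a * 1 = a := by
  obtain ⟨a, rfl⟩ := mk_surjective a
  induction a using induction_word with
  | h0 => rw [map_zero, zero_mul']
  | hw w =>
    have h1 : (1 : FreeDialgebra k n) ∈ homogeneous k p 0 := word_mem_homogeneous p (.of 0)
    have h := mem_ideal_of_relation (.comm _ _ _ _ (word_mem_homogeneous (k := k) p w) h1)
    rw [← mk_eq_mk, map_smul, mk_mul, mk_mul, mk_one, one_mul'] at h
    simpa [sign] using h
  | hadd a b ha hb => rw [map_add, add_mul', ha, hb]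
  | hsmul t a ha => rw [map_smul, smul_mul', ha]

theorem mul_assoc' (a b c : GenP k p) : a * b * c = a * (b * c) := by
  obtain ⟨a, rfl⟩ := mk_surjective a
  obtain ⟨b, rfl⟩ := mk_surjective b
  obtain ⟨c, rfl⟩ := mk_surjective c
  induction a using induction_word with
  | h0 => simp only [map_zero, zero_mul']
  | hadd a a' ha ha' => simp only [map_add, add_mul', ha, ha']
  | hsmul t a ha => simp only [map_smul, smul_mul', ha]
  | hw u =>
    induction b using induction_word with
    | h0 => simp only [map_zero, zero_mul', mul_zero']
    | hadd b b' hb hb' => simp only [map_add, add_mul', mul_add', hb, hb']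
    | hsmul t b hb => simp only [map_smul, smul_mul', mul_smul', hb]
    | hw v =>
      induction c using induction_word with
      | h0 => simp only [map_zero, mul_zero']
      | hadd c c' hc hc' => simp only [map_add, mul_add', hc, hc']
      | hsmul t c hc => simp only [map_smul, mul_smul', hc]
      | hw w =>
        simp only [← mk_mul]
        rw [mk_eq_mk]
        exact mem_ideal_of_relation (.assoc _ _ _ _ _ _ (word_mem_homogeneous p u)
          (word_mem_homogeneous p v) (word_mem_homogeneous p w))

noncomputable instance : Ring (GenP k p) where
  __ := (inferInstance : AddCommGroup (GenP k p))
  left_distrib := mul_add'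
  right_distrib := add_mul'
  zero_mul := zero_mul'
  mul_zero := mul_zero'
  mul_assoc := mul_assoc'
  one_mul := one_mul'
  mul_one := mul_one'

/-- The value in `GenP` of a word in the letters `1, x_1, …, x_n` and the bracket. -/
noncomputable def ofLieWord (k : Type*) [Field k] {n : ℕ} (p : Fin n → ZMod 2) :
    LieWord n → GenP k p
  | .of x => mk k p (word (DiWord.of x))
  | u * v => ⁅ofLieWord k p u, ofLieWord k p v⁆

/-- The formal monomials `e_{i_1}^{k_1} ⋯ e_{i_m}^{k_m}`, as lists of pairs `(e_{i_j}, k_j)`: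
`e_{i_1} < ⋯ < e_{i_m}` are elements of `M` other than `1`, the exponents are nonzero, and odd
elements have exponent `1`.  The empty list is the monomial `1`. -/
def monomials {n : ℕ} (p : Fin n → ZMod 2) (lt : LieWord n → LieWord n → Prop) :
    Set (List (LieWord n × ℕ)) :=
  {l | l.Pairwise (fun q r => LieWord.DegLexLT q.1 r.1) ∧
    ∀ q ∈ l, q.1 ∈ LieWord.shternSet p lt ∧ q.1 ≠ FreeMagma.of 0 ∧ q.2 ≠ 0 ∧
      (q.1.parity p = 1 → q.2 = 1)}

/-- The value in `GenP` of a formal monomial. -/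
noncomputable def ofMonomial (k : Type*) [Field k] {n : ℕ} (p : Fin n → ZMod 2)
    (l : List (LieWord n × ℕ)) : GenP k p :=
  (l.map (fun q => ofLieWord k p q.1 ^ q.2)).prod

end GenP

/-! Spanning. Leibniz and anticommutativity show that products of bracket words are closed under
both operations, so they span `GenP`. A Hall-type rewriting argument
(`IsSuperLieEval.mem_shternSpan`) replaces each bracket word by elements of `M`, supercommutativity
sorts the factors and kills odd squares, and the letter `1` disappears as a factor because it is the
unit (`standardListSpan_eq_top`).

Independence. Let L be the free Lie superalgebra on all n + 1 letters, with t the letter that stands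
for `1`. A Poisson superalgebra with an invertible even element τ becomes a unital generalized
Poisson superalgebra under the same bracket, the product a b τ⁻¹ and the unit τ. Applied to S(L),
suitably completed, with τ = 1 + t, this should send a monomial of m factors to itself plus terms of
higher degree, which gives independence.

S(L) is realised as a semiclassical limit. In power series over the free associative algebra, take
those whose coefficient of X^m uses at most m bracket factors, modulo those using fewer than m.
Supercommutators are divisible by X, and the quotient [a,b]/X is the Poisson bracket. The unit
becomes 1 + tX. All defining relations hold modulo the negligible series (`ideal_le_seriesKernel`),
and the lowest coefficient of the series of a product is the associative product of its factors
(`coeff_series_listToDiWord`).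

What remains is a Poincaré–Birkhoff–Witt statement in the free associative algebra: ordered products
of elements of `M` are independent (`linearIndependent_prodEval`). It is obtained by counting. Such
products with at most d letters span all letter words of length at most d. They are no more numerous
than these words, since a nondecreasing sequence of good words can be recovered from its letters
(`eq_of_flatMap_letters_eq`). -/

theorem ZMod.two_eq_zero_or_one (i : ZMod 2) : i = 0 ∨ i = 1 := by
  revert i; decide

/-! ### The sign rule as a bicharacter on `ZMod 2` -/

namespace FreeDialgebra

theorem sign_comm (k : Type*) [Field k] (i j : ZMod 2) : sign k i j = sign k j i := by
  rw [sign, sign, mul_comm]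

theorem sign_mul_self (k : Type*) [Field k] (i j : ZMod 2) :
    sign k i j * sign k i j = 1 := by
  rw [sign, ← mul_pow, neg_one_mul, neg_neg, one_pow]

theorem sign_zero_left (k : Type*) [Field k] (j : ZMod 2) : sign k 0 j = 1 := by
  simp [sign]

theorem sign_zero_right (k : Type*) [Field k] (j : ZMod 2) : sign k j 0 = 1 := by
  simp [sign]

theorem sign_one_one (k : Type*) [Field k] : sign k 1 1 = -1 := by
  simp [sign, ZMod.val_one]

theorem sign_add_left (k : Type*) [Field k] (i j l : ZMod 2) :
    sign k (i + j) l = sign k i l * sign k j l := by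
  have h : (1 : ZMod 2) + 1 = 0 := by decide
  rcases ZMod.two_eq_zero_or_one i with rfl | rfl <;>
  rcases ZMod.two_eq_zero_or_one j with rfl | rfl <;>
  rcases ZMod.two_eq_zero_or_one l with rfl | rfl <;>
  simp [sign_zero_left, sign_zero_right, sign_one_one, h]

theorem sign_add_right (k : Type*) [Field k] (i j l : ZMod 2) :
    sign k i (j + l) = sign k i j * sign k i l := by
  rw [sign_comm, sign_add_left, sign_comm k j, sign_comm k l]

end FreeDialgebra

theorem FreeMagma.finite_setOf_length_le {α : Type*} [Finite α] (d : ℕ) :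
    {w : FreeMagma α | w.length ≤ d}.Finite := by
  induction d with
  | zero =>
    refine Set.Finite.subset Set.finite_empty fun w hw => ?_
    have := w.length_pos
    simp only [Set.mem_ofPred_eq] at hw
    omega
  | succ d ih =>
    refine ((Set.finite_range (FreeMagma.of : α → FreeMagma α)).union
      (Set.Finite.image2 (· * ·) ih ih)).subset fun w hw => ?_
    cases w with
    | of x => exact Or.inl ⟨x, rfl⟩
    | mul u v =>
      have hu := u.length_pos
      have hv := v.length_pos
      change u.length + v.length ≤ d + 1 at hw
      exact Or.inr ⟨u, by simp only [Set.mem_ofPred_eq]; omega, v,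
        by simp only [Set.mem_ofPred_eq]; omega, rfl⟩

/-! ### Hall-type rewriting of bracket words into elements of `M` -/

namespace LieWord

open FreeDialgebra

section Order

variable {n : ℕ} {lt : LieWord n → LieWord n → Prop}

theorem isGood_mul_iff {u v : LieWord n} : IsGood lt (u * v) ↔ IsGood lt u ∧ IsGood lt v ∧ lt v u ∧
    ∀ u₁ u₂ : LieWord n, u = u₁ * u₂ → u₂ = v ∨ lt u₂ v := Iff.rfl

theorem parity_mul (p : Fin n → ZMod 2) (u v : LieWord n) :
    parity p (u * v) = parity p u + parity p v := rfl

theorem parity_mul_self (p : Fin n → ZMod 2) (v : LieWord n) : parity p (v * v) = 0 := by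
  rw [parity_mul]
  exact CharTwo.add_self_eq_zero _

theorem length_mul (u v : LieWord n) : (u * v).length = u.length + v.length := rfl

theorem mul_inj {u v u' v' : LieWord n} (h : u * v = u' * v') : u = u' ∧ v = v' := by
  change FreeMagma.mul u v = FreeMagma.mul u' v' at h
  injection h with h₁ h₂
  exact ⟨h₁, h₂⟩

theorem IsAdmissibleOrder.not_isGood_mul_self (hlt : IsAdmissibleOrder lt) (v : LieWord n) :
    ¬ IsGood lt (v * v) := fun h => hlt.irrefl v h.1 h.2.2.1

/-- Only finitely many words have bounded length, so descending induction is available for an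
admissible order even though it need not respect length. -/
theorem IsAdmissibleOrder.wellFounded_gt (hlt : IsAdmissibleOrder lt) (d : ℕ) :
    WellFounded fun a b : {v : LieWord n // IsGood lt v ∧ v.length < d} => lt b.1 a.1 := by
  have : Finite {v : LieWord n // IsGood lt v ∧ v.length < d} :=
    ((FreeMagma.finite_setOf_length_le d).subset fun v hv => hv.2.le).to_subtype
  have : IsTrans {v : LieWord n // IsGood lt v ∧ v.length < d} fun a b => lt b.1 a.1 :=
    ⟨fun a b c hab hbc => hlt.trans _ _ _ c.2.1 b.2.1 a.2.1 hbc hab⟩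
  have : Std.Irrefl fun a b : {v : LieWord n // IsGood lt v ∧ v.length < d} => lt b.1 a.1 :=
    ⟨fun a => hlt.irrefl _ a.2.1⟩
  exact Finite.wellFounded_of_trans_of_irrefl _

end Order

/-- `E` evaluates bracket words in a vector space with a bilinear operation `B` that satisfies
super anticommutativity and the super Jacobi identity on the values of words. -/
structure IsSuperLieEval {k V : Type*} [Field k] [AddCommGroup V] [Module k V] {n : ℕ}
    (p : Fin n → ZMod 2) (B : V →ₗ[k] V →ₗ[k] V) (E : LieWord n → V) : Prop where
  mul : ∀ u v, E (u * v) = B (E u) (E v)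
  anticomm : ∀ u v, B (E u) (E v) = -(sign k (parity p u) (parity p v) • B (E v) (E u))
  jacobi : ∀ u v w, B (B (E u) (E v)) (E w) =
    B (E u) (B (E v) (E w)) - sign k (parity p u) (parity p v) • B (E v) (B (E u) (E w))

/-- The words `{a, b}` of `M` of length `d` with `b ≥ v` and `a > v`. -/
def shternTail {n : ℕ} (p : Fin n → ZMod 2) (lt : LieWord n → LieWord n → Prop) (v : LieWord n)
    (d : ℕ) : Set (LieWord n) :=
  {w | ∃ a b, w = a * b ∧ w ∈ shternSet p lt ∧ (b = v ∨ lt v b) ∧ lt v a ∧ w.length = d}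

section Hall

variable {k V : Type*} [Field k] [AddCommGroup V] [Module k V] {n : ℕ}
  {p : Fin n → ZMod 2} {B : V →ₗ[k] V →ₗ[k] V} {E : LieWord n → V}
  {lt : LieWord n → LieWord n → Prop}

theorem IsSuperLieEval.apply_mul_mem (h : IsSuperLieEval p B E) {S : Set (LieWord n)}
    {W : Submodule k V} {x y : LieWord n} (hy : E y ∈ Submodule.span k (E '' S))
    (hS : ∀ w ∈ S, E (x * w) ∈ W) : E (x * y) ∈ W := by
  rw [h.mul]
  have : Submodule.span k (E '' S) ≤ W.comap (B (E x)) := by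
    rw [Submodule.span_le]
    rintro _ ⟨w, hw, rfl⟩
    have := hS w hw
    rwa [h.mul] at this
  exact this hy

theorem IsSuperLieEval.swap (h : IsSuperLieEval p B E) (u v : LieWord n) :
    E (u * v) = -(sign k (parity p u) (parity p v) • E (v * u)) := by
  rw [h.mul, h.mul, h.anticomm]

theorem IsSuperLieEval.swap_mem (h : IsSuperLieEval p B E) {W : Submodule k V} {u v : LieWord n}
    (hW : E (v * u) ∈ W) : E (u * v) ∈ W := by
  rw [h.swap]
  exact W.neg_mem (W.smul_mem _ hW)

theorem IsSuperLieEval.mul_mul (h : IsSuperLieEval p B E) (u v w : LieWord n) :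
    E (u * v * w) = E (u * (v * w)) - sign k (parity p u) (parity p v) • E (v * (u * w)) := by
  simp only [h.mul, h.jacobi]

/-- For an odd z the two terms of the Jacobi identity coincide and add up instead of cancelling. -/
theorem IsSuperLieEval.mul_self_mul (h : IsSuperLieEval p B E) {z : LieWord n}
    (hz : parity p z = 1) (y : LieWord n) : E (z * z * y) = (2 : k) • E (z * (z * y)) := by
  rw [h.mul_mul, hz, sign_one_one, two_smul]
  simp

/-- The span of the values of the elements of `M` of length `d`. -/
def shternSpan (p : Fin n → ZMod 2) (lt : LieWord n → LieWord n → Prop) (k : Type*) [Field k]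
    {V : Type*} [AddCommGroup V] [Module k V] (E : LieWord n → V) (d : ℕ) : Submodule k V :=
  Submodule.span k (E '' {w | w ∈ shternSet p lt ∧ w.length = d})

theorem mem_shternSpan {w : LieWord n} (hw : w ∈ shternSet p lt) :
    E w ∈ shternSpan p lt k E w.length :=
  Submodule.subset_span ⟨w, ⟨hw, rfl⟩, rfl⟩

theorem span_shternTail_le (v : LieWord n) (d : ℕ) :
    Submodule.span k (E '' shternTail p lt v d) ≤ shternSpan p lt k E d := by
  refine Submodule.span_mono (Set.image_mono ?_)
  rintro w ⟨a, b, rfl, hM, -, -, hd⟩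
  exact ⟨hM, hd⟩

variable [CharZero k]

theorem IsSuperLieEval.mul_self_of_even (h : IsSuperLieEval p B E) {x : LieWord n}
    (hx : parity p x = 0) : E (x * x) = 0 := by
  have h1 := h.swap x x
  rw [hx, sign_zero_left, one_smul] at h1
  have h2 : (2 : k) • E (x * x) = 0 := by
    rw [two_smul]
    nth_rw 1 [h1]
    simp
  exact (smul_eq_zero.1 h2).resolve_left two_ne_zero

/-- Jacobi gives {{z,z},z} = 2{z,{z,z}}, anticommutativity gives {{z,z},z} = -{z,{z,z}}; the
difference is three times the element. -/
theorem IsSuperLieEval.mul_self_mul_self (h : IsSuperLieEval p B E) {z : LieWord n}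
    (hz : parity p z = 1) : E (z * (z * z)) = 0 := by
  have h1 := h.mul_self_mul hz z
  rw [h.swap, parity_mul_self, sign_zero_left, one_smul] at h1
  have h2 : (3 : k) • E (z * (z * z)) = 0 := by
    have : (3 : k) = 2 + 1 := by norm_num
    rw [this, add_smul, ← h1]
    simp
  exact (smul_eq_zero.1 h2).resolve_left three_ne_zero

theorem shternTail_mono (hlt : IsAdmissibleOrder lt) {v v' : LieWord n} (hv : IsGood lt v)
    (hv' : IsGood lt v') (h : lt v v') (d : ℕ) : shternTail p lt v' d ⊆ shternTail p lt v d := by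
  rintro _ ⟨a, b, rfl, hM, hb, ha, hd⟩
  have hab : IsGood lt a ∧ IsGood lt b := by
    rcases hM with hM | ⟨z, hz, -, e⟩
    · exact ⟨hM.1, hM.2.1⟩
    · obtain ⟨rfl, rfl⟩ := mul_inj e
      exact ⟨hz, hz⟩
  refine ⟨a, b, rfl, hM, Or.inr ?_, hlt.trans _ _ _ hv hv' hab.1 h ha, hd⟩
  rcases hb with rfl | hb
  · exact h
  · exact hlt.trans _ _ _ hv hv' hab.2 h hb

/-- Since {a,b} > a > v for a good {a,b}, every element of a tail is made from a single good word
above v, to which the hypothesis for larger words can be applied. -/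
theorem mem_shternTail_iff (hlt : IsAdmissibleOrder lt) {v w : LieWord n} (hv : IsGood lt v) {d : ℕ}
    (hw : w ∈ shternTail p lt v d) : w.length = d ∧ ((IsGood lt w ∧ lt v w) ∨
      ∃ z, IsGood lt z ∧ parity p z = 1 ∧ lt v z ∧ w = z * z) := by
  obtain ⟨a, b, rfl, hM, hb, ha, hd⟩ := hw
  refine ⟨hd, ?_⟩
  rcases hM with hM | ⟨z, hz, hz1, e⟩
  · exact Or.inl ⟨hM, hlt.trans _ _ _ hv hM.1 hM ha (hlt.lt_mul _ _ hM).1⟩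
  · obtain ⟨rfl, rfl⟩ := mul_inj e
    exact Or.inr ⟨_, hz, hz1, ha, rfl⟩

/-- The three statements proved simultaneously about brackets of total length `d` whose smaller
argument is built from `v`. -/
def TailStatement (p : Fin n → ZMod 2) (lt : LieWord n → LieWord n → Prop) (k : Type*) [Field k]
    {V : Type*} [AddCommGroup V] [Module k V] (E : LieWord n → V) (d : ℕ) (v : LieWord n) : Prop :=
  (∀ u, IsGood lt u → lt v u → u.length + v.length = d →
    E (u * v) ∈ Submodule.span k (E '' shternTail p lt v d)) ∧
  (∀ z, IsGood lt z → parity p z = 1 → lt v z → z.length + z.length + v.length = d →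
    E (z * z * v) ∈ Submodule.span k (E '' shternTail p lt v d)) ∧
  (∀ y, IsGood lt y → parity p v = 1 → lt v y → v.length + v.length + y.length = d →
    E (v * v * y) ∈ Submodule.span k (E '' shternTail p lt v d))

/-- Both arguments come from good words above v. The smaller of the two words serves as the new v',
and the tail of v' lies in the tail of v. -/
theorem IsSuperLieEval.mul_mem_of_tailStatement (h : IsSuperLieEval p B E)
    (hlt : IsAdmissibleOrder lt) {d : ℕ} {v : LieWord n} (hv : IsGood lt v)
    (ih : ∀ v', IsGood lt v' → v'.length < d → lt v v' → TailStatement p lt k E d v')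
    {x w : LieWord n} (hx : IsGood lt x) (hvx : lt v x) {e : ℕ} (hw : w ∈ shternTail p lt v e)
    (hd : x.length + e = d) : E (x * w) ∈ Submodule.span k (E '' shternTail p lt v d) := by
  have mono : ∀ v', IsGood lt v' → lt v v' →
      Submodule.span k (E '' shternTail p lt v' d) ≤ Submodule.span k (E '' shternTail p lt v d) :=
    fun v' hv' hvv' => Submodule.span_mono (Set.image_mono (shternTail_mono hlt hv hv' hvv' d))
  have px := x.length_pos
  obtain ⟨rfl, ⟨hwg, hvw⟩ | ⟨z, hz, hz1, hvz, rfl⟩⟩ := mem_shternTail_iff hlt hv hw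
  · have pw := w.length_pos
    rcases hlt.total x w hx hwg with hxw | rfl | hwx
    · apply h.swap_mem
      exact mono x hx hvx ((ih x hx (by omega) hvx).1 w hwg hxw (by omega))
    · rcases ZMod.two_eq_zero_or_one (parity p x) with h0 | h1
      · rw [h.mul_self_of_even h0]
        exact zero_mem _
      · exact Submodule.subset_span ⟨_, ⟨x, x, rfl, Or.inr ⟨x, hx, h1, rfl⟩, Or.inr hvx, hvx, hd⟩,
          rfl⟩
    · exact mono w hwg hvw ((ih w hwg (by omega) hvw).1 x hx hwx hd)
  · have pz := z.length_pos
    rw [length_mul] at hd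
    rcases hlt.total x z hx hz with hxz | rfl | hzx
    · apply h.swap_mem
      exact mono x hx hvx ((ih x hx (by omega) hvx).2.1 z hz hz1 hxz (by omega))
    · rw [h.mul_self_mul_self hz1]
      exact zero_mem _
    · apply h.swap_mem
      exact mono z hz hvz ((ih z hz (by omega) hvz).2.2 x hx hz1 hzx (by omega))

/-- The outer induction is on the total length, the inner one descends in v: rewriting a bracket
with smaller argument v leaves v in place or raises the smaller argument. -/
theorem IsSuperLieEval.tailStatement (h : IsSuperLieEval p B E) (hlt : IsAdmissibleOrder lt)
    (d : ℕ) : ∀ v, IsGood lt v → v.length < d → TailStatement p lt k E d v := by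
  induction d using Nat.strong_induction_on with
  | _ d ihd =>
  have lower : ∀ u v, IsGood lt u → IsGood lt v → lt v u → u.length + v.length < d →
      E (u * v) ∈ Submodule.span k (E '' shternTail p lt v (u.length + v.length)) := by
    intro u v hu hv huv hd
    have := u.length_pos
    exact (ihd _ hd v hv (by omega)).1 u hu huv rfl
  suffices H : ∀ v : {v : LieWord n // IsGood lt v ∧ v.length < d}, TailStatement p lt k E d v.1 from
    fun v hv hd => H ⟨v, hv, hd⟩
  intro v
  induction v using (hlt.wellFounded_gt d).induction with
  | _ v ihv =>
  obtain ⟨v, hv, hvd⟩ := v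
  have ih : ∀ v', IsGood lt v' → v'.length < d → lt v v' → TailStatement p lt k E d v' :=
    fun v' hv' hd' hvv' => ihv ⟨v', hv', hd'⟩ hvv'
  have pv := v.length_pos
  have hP : ∀ u, IsGood lt u → lt v u → u.length + v.length = d →
      E (u * v) ∈ Submodule.span k (E '' shternTail p lt v d) := by
    intro u hu hvu hd
    by_cases hg : IsGood lt (u * v)
    · exact Submodule.subset_span ⟨_, ⟨u, v, rfl, Or.inl hg, Or.inl rfl, hvu, hd⟩, rfl⟩
    · rw [isGood_mul_iff] at hg
      push Not at hg
      obtain ⟨u₁, u₂, rfl, hne, hnlt⟩ := hg hu hv hvu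
      -- As u > v are good, goodness of {u,v} can only fail through u₂ > v. Jacobi then moves v
      -- inside. The inner brackets {u₂,v} and {u₁,v} are shorter and expand in the tail of v, after
      -- which both arguments of the outer bracket exceed v.
      have hvu₂ : lt v u₂ := ((hlt.total u₂ v hu.2.1 hv).resolve_left hnlt).resolve_left hne
      have hvu₁ : lt v u₁ := hlt.trans _ _ _ hv hu.2.1 hu.1 hvu₂ hu.2.2.1
      have p₁ := u₁.length_pos
      have p₂ := u₂.length_pos
      rw [length_mul] at hd
      rw [h.mul_mul]
      refine Submodule.sub_mem _ ?_ (Submodule.smul_mem _ _ ?_)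
      · exact h.apply_mul_mem (lower u₂ v hu.2.1 hv hvu₂ (by omega)) fun w hw =>
          h.mul_mem_of_tailStatement hlt hv ih hu.1 hvu₁ hw (by omega)
      · exact h.apply_mul_mem (lower u₁ v hu.1 hv hvu₁ (by omega)) fun w hw =>
          h.mul_mem_of_tailStatement hlt hv ih hu.2.1 hvu₂ hw (by omega)
  have hQ : ∀ z, IsGood lt z → parity p z = 1 → lt v z → z.length + z.length + v.length = d →
      E (z * z * v) ∈ Submodule.span k (E '' shternTail p lt v d) := by
    intro z hz hz1 hvz hd
    have pz := z.length_pos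
    rw [h.mul_self_mul hz1]
    refine Submodule.smul_mem _ _ ?_
    exact h.apply_mul_mem (lower z v hz hv hvz (by omega)) fun w hw =>
      h.mul_mem_of_tailStatement hlt hv ih hz hvz hw (by omega)
  refine ⟨hP, hQ, ?_⟩
  intro y hy hv1 hvy hd
  change v.length + v.length + y.length = d at hd
  have py := y.length_pos
  rw [h.mul_self_mul hv1]
  -- The outer factor is v itself, so the hypothesis for larger words does not apply; `hP` and `hQ`
  -- for this same v do.
  refine Submodule.smul_mem _ _ (h.apply_mul_mem (h.swap_mem (lower y v hy hv hvy (by omega))) ?_)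
  intro w hw
  obtain ⟨hwl, ⟨hwg, hvw⟩ | ⟨z, hz, hz1, hvz, rfl⟩⟩ := mem_shternTail_iff hlt hv hw
  · exact h.swap_mem (hP w hwg hvw (by omega))
  · exact h.swap_mem (hQ z hz hz1 hvz (by rw [length_mul] at hwl; omega))

theorem IsSuperLieEval.good_mul_mem (h : IsSuperLieEval p B E) (hlt : IsAdmissibleOrder lt)
    {x w : LieWord n} (hx : IsGood lt x) (hw : w ∈ shternSet p lt) :
    E (x * w) ∈ shternSpan p lt k E (x.length + w.length) := by
  have px := x.length_pos
  rcases hw with hw | ⟨z, hz, hz1, rfl⟩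
  · have pw := w.length_pos
    rcases hlt.total x w hx hw with hxw | rfl | hwx
    · exact h.swap_mem (span_shternTail_le _ _
        ((h.tailStatement hlt (x.length + w.length) x hx (by omega)).1 w hw hxw (by omega)))
    · rcases ZMod.two_eq_zero_or_one (parity p x) with h0 | h1
      · rw [h.mul_self_of_even h0]
        exact zero_mem _
      · exact mem_shternSpan (E := E) (w := x * x) (Or.inr ⟨x, hx, h1, rfl⟩)
    · exact span_shternTail_le _ _
        ((h.tailStatement hlt (x.length + w.length) w hw (by omega)).1 x hx hwx rfl)
  · have pz := z.length_pos
    rw [length_mul]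
    rcases hlt.total x z hx hz with hxz | rfl | hzx
    · exact h.swap_mem (span_shternTail_le _ _
        ((h.tailStatement hlt (x.length + (z.length + z.length)) x hx (by omega)).2.1 z hz hz1 hxz
          (by omega)))
    · rw [h.mul_self_mul_self hz1]
      exact zero_mem _
    · exact h.swap_mem (span_shternTail_le _ _
        ((h.tailStatement hlt (x.length + (z.length + z.length)) z hz (by omega)).2.2 x hx hz1 hzx
          (by omega)))

theorem IsSuperLieEval.mul_mem (h : IsSuperLieEval p B E) (hlt : IsAdmissibleOrder lt)
    {x w : LieWord n} (hx : x ∈ shternSet p lt) (hw : w ∈ shternSet p lt) :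
    E (x * w) ∈ shternSpan p lt k E (x.length + w.length) := by
  rcases hx with hx | ⟨z, hz, hz1, rfl⟩
  · exact h.good_mul_mem hlt hx hw
  · rw [h.mul_self_mul hz1]
    refine Submodule.smul_mem _ _ (h.apply_mul_mem (h.good_mul_mem hlt hz hw) ?_)
    rintro m ⟨hm, hml⟩
    have := h.good_mul_mem hlt hz hm
    rwa [hml, ← add_assoc] at this

/-- Every bracket word is a linear combination of elements of `M` of the same length. -/
theorem IsSuperLieEval.mem_shternSpan (h : IsSuperLieEval p B E) (hlt : IsAdmissibleOrder lt)
    (w : LieWord n) : E w ∈ shternSpan p lt k E w.length := by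
  induction w with
  | of x => exact LieWord.mem_shternSpan (Or.inl trivial)
  | mul u v hu hv =>
    change E (u * v) ∈ shternSpan p lt k E (u.length + v.length)
    refine h.apply_mul_mem hv ?_
    rintro m ⟨hm, hml⟩
    apply h.swap_mem
    refine h.apply_mul_mem hu ?_
    rintro m' ⟨hm', hml'⟩
    have := h.mul_mem hlt hm hm'
    rwa [hml, hml', add_comm] at this

end Hall

end LieWord

/-! ### Recovering nondecreasing lists of good words from their letters -/

namespace LieWord

variable {n : ℕ}

/-- The letters of a word, from left to right. -/
def letters : LieWord n → List (Fin (n + 1))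
  | .of x => [x]
  | u * v => letters u ++ letters v

theorem letters_mul (u v : LieWord n) : letters (u * v) = letters u ++ letters v := rfl

theorem length_letters (w : LieWord n) : (letters w).length = w.length := by
  induction w with
  | of x => rfl
  | mul u v hu hv =>
    change (letters (u * v)).length = (u * v).length
    rw [letters_mul, List.length_append, hu, hv, length_mul]

/-- The number of letters of a list of words. -/
def totalLength (s : List (LieWord n)) : ℕ := (s.map FreeMagma.length).sum

theorem length_flatMap_letters (s : List (LieWord n)) :
    (s.flatMap letters).length = totalLength s := by
  simp only [List.length_flatMap, length_letters, totalLength]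

section Decode

variable {lt : LieWord n → LieWord n → Prop}

open Classical in
/-- Insertion of a word `h` in a nondecreasing list of words: as long as `h` is greater than the
first word `s` of the list, both are replaced by `{h, s}`. -/
noncomputable def insertWord (lt : LieWord n → LieWord n → Prop) :
    LieWord n → List (LieWord n) → List (LieWord n)
  | h, [] => [h]
  | h, s :: l => if lt s h then insertWord lt (h * s) l else h :: s :: l

theorem insertWord_of_le {h : LieWord n} {s : List (LieWord n)} (hs : ∀ w ∈ s, ¬ lt w h) :
    insertWord lt h s = h :: s := by
  cases s with
  | nil => rfl
  | cons w s => rw [insertWord, if_neg (hs w List.mem_cons_self)]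

/-- For h = {u,v} the letters of v are read first and rebuild v in front of s; then u is rebuilt,
meets v < u and merges into {u,v}. The condition on the right factor of h prevents that factor from
merging with s too early. It passes to u because u₂ ≤ v, and to v because v₂ < v. -/
theorem foldr_letters (hlt : IsAdmissibleOrder lt) {h : LieWord n} (hh : IsGood lt h)
    {s : List (LieWord n)} (hs : s.Pairwise fun a b => ¬ lt b a) (hsg : ∀ w ∈ s, IsGood lt w)
    (hsh : ∀ a b, h = a * b → ∀ w ∈ s, ¬ lt w b) :
    (letters h).foldr (fun x => insertWord lt (FreeMagma.of x)) s = insertWord lt h s := by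
  induction h generalizing s with
  | of x => rfl
  | mul u v ihu ihv =>
    obtain ⟨hu, hv, hvu, hu₂⟩ := isGood_mul_iff.1 hh
    have hsv : ∀ w ∈ s, ¬ lt w v := hsh u v rfl
    have hvs : ∀ b, IsGood lt b → (b = v ∨ lt b v) → ∀ w ∈ s, ¬ lt w b := by
      intro b hb hbv w hw hwb
      rcases hbv with rfl | hbv
      · exact hsv w hw hwb
      · exact hsv w hw (hlt.trans _ _ _ (hsg w hw) hb hv hwb hbv)
    change (letters (u * v)).foldr _ s = insertWord lt (u * v) s
    rw [letters_mul, List.foldr_append, ihv hv hs hsg, insertWord_of_le hsv, ihu hu]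
    · rw [insertWord, if_pos hvu]
    · exact List.pairwise_cons.2 ⟨hsv, hs⟩
    · rintro w (_ | ⟨_, hw⟩)
      · exact hv
      · exact hsg w hw
    · rintro a b rfl w hw
      have hab := hu₂ a b rfl
      rcases List.mem_cons.1 hw with rfl | hw
      · rcases hab with rfl | hab
        · exact hlt.irrefl _ hv
        · exact fun h => hlt.irrefl _ hu.2.1 (hlt.trans _ _ _ hu.2.1 hv hu.2.1 hab h)
      · exact hvs b hu.2.1 hab w hw
    · rintro a b rfl
      exact hvs b hv.2.1 (Or.inr (hlt.lt_mul _ _ hv).2)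

theorem foldr_flatMap_letters (hlt : IsAdmissibleOrder lt) {s : List (LieWord n)}
    (hs : s.Pairwise fun a b => ¬ lt b a) (hsg : ∀ w ∈ s, IsGood lt w) :
    (s.flatMap letters).foldr (fun x => insertWord lt (FreeMagma.of x)) [] = s := by
  induction s with
  | nil => rfl
  | cons h s ih =>
    obtain ⟨hhs, hs'⟩ := List.pairwise_cons.1 hs
    have hsg' : ∀ w ∈ s, IsGood lt w := fun w hw => hsg w (List.mem_cons_of_mem _ hw)
    have hh := hsg h List.mem_cons_self
    rw [List.flatMap_cons, List.foldr_append, ih hs' hsg', foldr_letters hlt hh hs' hsg',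
      insertWord_of_le hhs]
    rintro a b rfl w hw hwb
    exact hhs w hw (hlt.trans _ _ _ (hsg' w hw) hh.2.1 hh hwb (hlt.lt_mul _ _ hh).2)

/-- A nondecreasing list of good words is determined by its letters. -/
theorem eq_of_flatMap_letters_eq (hlt : IsAdmissibleOrder lt) {s t : List (LieWord n)}
    (hs : s.Pairwise fun a b => ¬ lt b a) (hsg : ∀ w ∈ s, IsGood lt w)
    (ht : t.Pairwise fun a b => ¬ lt b a) (htg : ∀ w ∈ t, IsGood lt w)
    (h : s.flatMap letters = t.flatMap letters) : s = t := by
  rw [← foldr_flatMap_letters hlt hs hsg, h, foldr_flatMap_letters hlt ht htg]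

open Classical in
-- The relation is linear on good words only, so the sorting takes place in the subtype of good
-- words.
theorem exists_perm_pairwise (hlt : IsAdmissibleOrder lt) (s : List (LieWord n))
    (hs : ∀ w ∈ s, IsGood lt w) : ∃ t : List (LieWord n), t.Perm s ∧
      t.Pairwise fun a b => ¬ lt b a := by
  let r : {w // IsGood lt w} → {w // IsGood lt w} → Prop := fun a b => ¬ lt b.1 a.1
  have : Std.Total r := ⟨fun a b => by
    by_contra! h
    obtain ⟨h1, h2⟩ := h
    simp only [r, not_not] at h1 h2
    exact hlt.irrefl _ a.2 (hlt.trans _ _ _ a.2 b.2 a.2 h2 h1)⟩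
  have : IsTrans _ r := ⟨fun a b c hab hbc hca => by
    rcases hlt.total _ _ a.2 b.2 with h | h | h
    · exact hbc (hlt.trans _ _ _ c.2 a.2 b.2 hca h)
    · exact hbc (h ▸ hca)
    · exact hab h⟩
  refine ⟨((s.attachWith _ hs).insertionSort r).map Subtype.val, ?_, ?_⟩
  · have := (List.perm_insertionSort r (s.attachWith _ hs)).map Subtype.val
    rwa [List.attachWith_map_subtype_val] at this
  · rw [List.pairwise_map]
    exact List.pairwise_insertionSort r _

end Decode

/-! ### The degree-lexicographic order is a strict linear order -/

section DegLex

theorem degLexLT_mul {u₁ u₂ v₁ v₂ : LieWord n} : DegLexLT (u₁ * u₂) (v₁ * v₂) ↔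
    (u₁ * u₂).length < (v₁ * v₂).length ∨
      ((u₁ * u₂).length = (v₁ * v₂).length ∧ (DegLexLT u₁ v₁ ∨ (u₁ = v₁ ∧ DegLexLT u₂ v₂))) :=
  Iff.rfl

theorem degLexLT_irrefl (u : LieWord n) : ¬ DegLexLT u u := by
  induction u with
  | of x => exact lt_irrefl x
  | mul u v hu hv =>
    change ¬ DegLexLT (u * v) (u * v)
    rw [degLexLT_mul]
    rintro (h | ⟨-, h | ⟨-, h⟩⟩)
    · exact lt_irrefl _ h
    · exact hu h
    · exact hv h

theorem degLexLT_trans {u v w : LieWord n} (h₁ : DegLexLT u v) (h₂ : DegLexLT v w) :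
    DegLexLT u w := by
  induction u generalizing v w with
  | of x =>
    cases w with
    | mul w₁ w₂ => trivial
    | of z =>
      cases v with
      | mul v₁ v₂ => exact h₂.elim
      | of y => exact lt_trans (α := Fin (n + 1)) h₁ h₂
  | mul u₁ u₂ ih₁ ih₂ =>
    cases v with
    | of y => exact h₁.elim
    | mul v₁ v₂ =>
      cases w with
      | of z => exact h₂.elim
      | mul w₁ w₂ =>
        replace h₁ := degLexLT_mul.1 h₁
        replace h₂ := degLexLT_mul.1 h₂
        refine degLexLT_mul.2 ?_
        rcases h₁ with h₁ | ⟨e₁, h₁⟩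
        · rcases h₂ with h₂ | ⟨e₂, h₂⟩
          · exact Or.inl (h₁.trans h₂)
          · exact Or.inl (e₂ ▸ h₁)
        · rcases h₂ with h₂ | ⟨e₂, h₂⟩
          · exact Or.inl (e₁ ▸ h₂)
          · refine Or.inr ⟨e₁.trans e₂, ?_⟩
            rcases h₁ with h₁ | ⟨rfl, h₁⟩
            · rcases h₂ with h₂ | ⟨rfl, h₂⟩
              · exact Or.inl (ih₁ h₁ h₂)
              · exact Or.inl h₁
            · rcases h₂ with h₂ | ⟨rfl, h₂⟩
              · exact Or.inl h₂
              · exact Or.inr ⟨rfl, ih₂ h₁ h₂⟩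

theorem degLexLT_total (u v : LieWord n) : DegLexLT u v ∨ u = v ∨ DegLexLT v u := by
  induction u generalizing v with
  | of x =>
    cases v with
    | of y =>
      rcases lt_trichotomy x y with h | rfl | h
      · exact Or.inl h
      · exact Or.inr (Or.inl rfl)
      · exact Or.inr (Or.inr h)
    | mul v₁ v₂ => exact Or.inl trivial
  | mul u₁ u₂ ih₁ ih₂ =>
    cases v with
    | of y => exact Or.inr (Or.inr trivial)
    | mul v₁ v₂ =>
      change DegLexLT (u₁ * u₂) (v₁ * v₂) ∨ u₁ * u₂ = v₁ * v₂ ∨ DegLexLT (v₁ * v₂) (u₁ * u₂)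
      rw [degLexLT_mul, degLexLT_mul]
      rcases lt_trichotomy (u₁ * u₂).length (v₁ * v₂).length with h | h | h
      · exact Or.inl (Or.inl h)
      · rcases ih₁ v₁ with h₁ | rfl | h₁
        · exact Or.inl (Or.inr ⟨h, Or.inl h₁⟩)
        · rcases ih₂ v₂ with h₂ | rfl | h₂
          · exact Or.inl (Or.inr ⟨h, Or.inr ⟨rfl, h₂⟩⟩)
          · exact Or.inr (Or.inl rfl)
          · exact Or.inr (Or.inr (Or.inr ⟨h.symm, Or.inr ⟨rfl, h₂⟩⟩))
        · exact Or.inr (Or.inr (Or.inr ⟨h.symm, Or.inl h₁⟩))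
      · exact Or.inr (Or.inr (Or.inl h))

end DegLex

/-! ### Encoding standard lists by words in the letters -/

section Standard

variable {p : Fin n → ZMod 2} {lt : LieWord n → LieWord n → Prop}

/-- Standard lists: nondecreasing lists of elements of `M` without repetition of odd elements. -/
def IsStandard (p : Fin n → ZMod 2) (lt : LieWord n → LieWord n → Prop) (s : List (LieWord n)) :
    Prop :=
  s.Pairwise (fun a b => DegLexLT a b ∨ (a = b ∧ parity p a = 0)) ∧ ∀ w ∈ s, w ∈ shternSet p lt

theorem IsStandard.eq_of_perm {s t : List (LieWord n)} (hs : IsStandard p lt s)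
    (ht : IsStandard p lt t) (h : s.Perm t) : s = t := by
  refine h.eq_of_pairwise ?_ hs.1 ht.1
  rintro a b - - (hab | ⟨hab, -⟩) (hba | ⟨hba, -⟩)
  · exact (degLexLT_irrefl _ (degLexLT_trans hab hba)).elim
  · exact hba.symm
  · exact hab
  · exact hab

open Classical in
/-- The good words of which an element of `M` is composed. -/
noncomputable def goodParts (lt : LieWord n → LieWord n → Prop) (w : LieWord n) :
    List (LieWord n) :=
  if IsGood lt w then [w] else
    match w with
    -- This branch is never reached, since letters are good.
    | .of x => [.of x]
    | u * v => [u, v]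

theorem goodParts_of_isGood {w : LieWord n} (hw : IsGood lt w) : goodParts lt w = [w] :=
  if_pos hw

theorem goodParts_mul_self (hlt : IsAdmissibleOrder lt) (v : LieWord n) :
    goodParts lt (v * v) = [v, v] :=
  if_neg (hlt.not_isGood_mul_self v)

theorem isGood_of_mem_goodParts (hlt : IsAdmissibleOrder lt) {w z : LieWord n}
    (hw : w ∈ shternSet p lt) (hz : z ∈ goodParts lt w) : IsGood lt z := by
  rcases hw with hw | ⟨v, hv, -, rfl⟩
  · rw [goodParts_of_isGood hw, List.mem_singleton] at hz
    rwa [hz]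
  · rw [goodParts_mul_self hlt] at hz
    simp only [List.mem_cons, List.not_mem_nil, or_false, or_self] at hz
    rwa [hz]

theorem totalLength_goodParts (hlt : IsAdmissibleOrder lt) {w : LieWord n}
    (hw : w ∈ shternSet p lt) : totalLength (goodParts lt w) = w.length := by
  rcases hw with hw | ⟨v, hv, -, rfl⟩
  · simp [goodParts_of_isGood hw, totalLength]
  · simp [goodParts_mul_self hlt, totalLength]

theorem totalLength_flatMap_goodParts (hlt : IsAdmissibleOrder lt) {s : List (LieWord n)}
    (hs : ∀ w ∈ s, w ∈ shternSet p lt) :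
    totalLength (s.flatMap (goodParts lt)) = totalLength s := by
  induction s with
  | nil => rfl
  | cons w s ih =>
    have h1 := totalLength_goodParts hlt (hs w List.mem_cons_self)
    have h2 := ih fun z hz => hs z (List.mem_cons_of_mem _ hz)
    simp only [totalLength, List.flatMap_cons, List.map_append, List.sum_append, List.map_cons,
      List.sum_cons] at h1 h2 ⊢
    rw [h1, h2]

open Classical in
theorem count_flatMap_goodParts (hlt : IsAdmissibleOrder lt) {s : List (LieWord n)}
    (hs : ∀ w ∈ s, w ∈ shternSet p lt) {v : LieWord n} (hv : IsGood lt v) :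
    (s.flatMap (goodParts lt)).count v = s.count v + 2 * s.count (v * v) := by
  induction s with
  | nil => rfl
  | cons w s ih =>
    rw [List.flatMap_cons, List.count_append, ih fun z hz => hs z (List.mem_cons_of_mem _ hz),
      List.count_cons, List.count_cons]
    rcases hs w List.mem_cons_self with hw | ⟨z, hz, -, rfl⟩
    · have hne : w ≠ v * v := fun e => hlt.not_isGood_mul_self v (e ▸ hw)
      rw [goodParts_of_isGood hw, List.count_singleton]
      simp only [beq_iff_eq, hne, if_false]
      omega
    · have hne : z * z ≠ v := fun e => hlt.not_isGood_mul_self z (e ▸ hv)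
      have hiff : z * z = v * v ↔ z = v := ⟨fun e => (mul_inj e).1, fun e => by rw [e]⟩
      rw [goodParts_mul_self hlt, List.count_cons, List.count_singleton]
      simp only [beq_iff_eq, hne, hiff, if_false]
      split_ifs <;> omega

open Classical in
theorem IsStandard.count_le_one {s : List (LieWord n)} (hs : IsStandard p lt s) {v : LieWord n}
    (hv : parity p v = 1) : s.count v ≤ 1 := by
  obtain ⟨hs, -⟩ := hs
  induction s with
  | nil => simp
  | cons w s ih =>
    obtain ⟨h1, h2⟩ := List.pairwise_cons.1 hs
    rw [List.count_cons]
    by_cases hwv : w = v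
    · subst hwv
      have : s.count w = 0 := by
        rw [List.count_eq_zero]
        intro hw
        rcases h1 w hw with h | ⟨-, h⟩
        · exact degLexLT_irrefl _ h
        · rw [hv] at h
          exact one_ne_zero h
      simp [this]
    · simpa [hwv] using ih h2

open Classical in
-- An odd v occurs ε + 2m times among the parts, where ε ≤ 1 counts v and m counts {v,v}; division
-- by 2 recovers both. For an even v the word {v,v} is not in `M`, so the count is that of v alone.
theorem IsStandard.perm_of_flatMap_goodParts (hlt : IsAdmissibleOrder lt) {s t : List (LieWord n)}
    (hs : IsStandard p lt s) (ht : IsStandard p lt t)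
    (h : (s.flatMap (goodParts lt)).Perm (t.flatMap (goodParts lt))) : s.Perm t := by
  rw [List.perm_iff_count] at h ⊢
  have key : ∀ v, IsGood lt v → s.count v = t.count v ∧ s.count (v * v) = t.count (v * v) := by
    intro v hv
    have hc := h v
    rw [count_flatMap_goodParts hlt hs.2 hv, count_flatMap_goodParts hlt ht.2 hv] at hc
    rcases ZMod.two_eq_zero_or_one (parity p v) with h0 | h1
    · have hM : v * v ∉ shternSet p lt := by
        rintro (hg | ⟨z, -, hz, e⟩)
        · exact hlt.not_isGood_mul_self v hg
        · rw [← (mul_inj e).1, h0] at hz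
          exact zero_ne_one hz
      rw [List.count_eq_zero.2 fun hm => hM (hs.2 _ hm),
        List.count_eq_zero.2 fun hm => hM (ht.2 _ hm)] at hc ⊢
      omega
    · have := hs.count_le_one h1
      have := ht.count_le_one h1
      omega
  intro w
  by_cases hw : w ∈ shternSet p lt
  · rcases hw with hw | ⟨z, hz, -, rfl⟩
    · exact (key w hw).1
    · exact (key z hz).2
  · rw [List.count_eq_zero.2 fun hm => hw (hs.2 _ hm), List.count_eq_zero.2 fun hm => hw (ht.2 _ hm)]

/-- Standard lists can be encoded by words in the letters, with preservation of length. -/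
theorem exists_injOn_isStandard (p : Fin n → ZMod 2) (hlt : IsAdmissibleOrder lt) :
    ∃ f : List (LieWord n) → List (Fin (n + 1)), Set.InjOn f {s | IsStandard p lt s} ∧
      ∀ s, IsStandard p lt s → (f s).length = totalLength s := by
  have hg : ∀ s, IsStandard p lt s → ∀ w ∈ s.flatMap (goodParts lt), IsGood lt w := by
    intro s hs w hw
    obtain ⟨z, hz, hwz⟩ := List.mem_flatMap.1 hw
    exact isGood_of_mem_goodParts hlt (hs.2 z hz) hwz
  have hex : ∀ s : List (LieWord n), ∃ t : List (LieWord n), IsStandard p lt s →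
      t.Perm (s.flatMap (goodParts lt)) ∧ t.Pairwise fun a b => ¬ lt b a := by
    intro s
    by_cases hs : IsStandard p lt s
    · obtain ⟨t, ht⟩ := exists_perm_pairwise hlt _ (hg s hs)
      exact ⟨t, fun _ => ht⟩
    · exact ⟨[], fun h => (hs h).elim⟩
  choose t ht using hex
  -- Split each {v,v}, sort the resulting good words by `lt`, and concatenate their letters; every
  -- stage can be undone.
  refine ⟨fun s => (t s).flatMap letters, ?_, ?_⟩
  · intro s hs s' hs' e
    have h1 := ht s hs
    have h2 := ht s' hs'
    have e' := eq_of_flatMap_letters_eq hlt h1.2 (fun w hw => hg s hs w (h1.1.subset hw)) h2.2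
      (fun w hw => hg s' hs' w (h2.1.subset hw)) e
    exact hs.eq_of_perm hs'
      (hs.perm_of_flatMap_goodParts hlt hs' (h1.1.symm.trans (e' ▸ h2.1)))
  · intro s hs
    rw [length_flatMap_letters, ← totalLength_flatMap_goodParts hlt hs.2]
    exact ((ht s hs).1.map _).sum_eq

end Standard

end LieWord

/-! ### Sorting products modulo a subspace -/

namespace LieWord

open FreeDialgebra

section Sorting

variable {k V : Type*} [Field k] [AddCommGroup V] [Module k V] {n : ℕ}
  {p : Fin n → ZMod 2} {lt : LieWord n → LieWord n → Prop}

/-- In a sorted list equal words are consecutive, so the only obstruction to being standard is a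
pair of equal odd neighbours. -/
theorem pairwise_or_exists_repetition {t : List (LieWord n)}
    (ht : t.Pairwise fun a b => DegLexLT a b ∨ a = b) :
    t.Pairwise (fun a b => DegLexLT a b ∨ (a = b ∧ parity p a = 0)) ∨
      ∃ l₁ l₂ v, t = l₁ ++ v :: v :: l₂ ∧ parity p v = 1 := by
  induction t with
  | nil => exact Or.inl List.Pairwise.nil
  | cons w t ih =>
    obtain ⟨hw, ht'⟩ := List.pairwise_cons.1 ht
    rcases ih ht' with h | ⟨l₁, l₂, v, rfl, hv⟩
    · rcases ZMod.two_eq_zero_or_one (parity p w) with h0 | h1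
      · exact Or.inl (List.pairwise_cons.2 ⟨fun b hb => (hw b hb).imp_right fun e => ⟨e, h0⟩, h⟩)
      · cases t with
        | nil => exact Or.inl (List.pairwise_singleton _ _)
        | cons z t =>
          rcases hw z List.mem_cons_self with hz | rfl
          · refine Or.inl (List.pairwise_cons.2 ⟨fun b hb => Or.inl ?_, h⟩)
            rcases List.mem_cons.1 hb with rfl | hb
            · exact hz
            · rcases (List.pairwise_cons.1 ht').1 b hb with hzb | rfl
              · exact degLexLT_trans hz hzb
              · exact hz
          · exact Or.inr ⟨[], t, w, rfl, h1⟩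
    · exact Or.inr ⟨w :: l₁, l₂, v, rfl, hv⟩

/-- A permutation is a chain of neighbour transpositions; the prefix lets each of them act inside
the whole list. The scalars may vanish at this level of generality, and membership is transferred
from t to s only. -/
theorem mem_of_perm {f : List (LieWord n) → V} {W : Submodule k V} {l : List (LieWord n)}
    (hswap : ∀ l₁ l₂ a b, (l₁ ++ a :: b :: l₂).Perm l →
      ∃ c : k, f (l₁ ++ a :: b :: l₂) - c • f (l₁ ++ b :: a :: l₂) ∈ W)
    {s t : List (LieWord n)} (h : s.Perm t) (pre : List (LieWord n)) (hs : (pre ++ s).Perm l)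
    (ht : f (pre ++ t) ∈ W) : f (pre ++ s) ∈ W := by
  induction h generalizing pre with
  | nil => exact ht
  | cons x _ ih =>
    have := ih (pre ++ [x]) (by simpa using hs) (by simpa using ht)
    simpa using this
  | swap x y s =>
    obtain ⟨c, hc⟩ := hswap pre s y x hs
    have := W.add_mem hc (W.smul_mem c ht)
    simpa using this
  | trans h₁ _ ih₁ ih₂ =>
    exact ih₁ pre hs (ih₂ pre ((h₁.symm.append_left pre).trans hs) ht)

open Classical in
/-- If transposing neighbours only matters modulo `W` and up to scalars, and repeated odd
neighbours give elements of `W`, then standard lists suffice modulo `W`. -/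
theorem mem_sup_span_isStandard {f : List (LieWord n) → V} {W : Submodule k V}
    {l : List (LieWord n)} (hl : ∀ w ∈ l, w ∈ shternSet p lt)
    (hswap : ∀ l₁ l₂ a b, (l₁ ++ a :: b :: l₂).Perm l →
      ∃ c : k, f (l₁ ++ a :: b :: l₂) - c • f (l₁ ++ b :: a :: l₂) ∈ W)
    (hodd : ∀ l₁ l₂ v, (l₁ ++ v :: v :: l₂).Perm l → parity p v = 1 →
      f (l₁ ++ v :: v :: l₂) ∈ W) :
    f l ∈ W ⊔ Submodule.span k (f '' {s | IsStandard p lt s ∧ s.Perm l}) := by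
  let r : LieWord n → LieWord n → Prop := fun a b => DegLexLT a b ∨ a = b
  have : Std.Total r := ⟨fun a b => by
    rcases degLexLT_total a b with h | rfl | h
    · exact Or.inl (Or.inl h)
    · exact Or.inl (Or.inr rfl)
    · exact Or.inr (Or.inl h)⟩
  have : IsTrans _ r := ⟨fun a b c hab hbc => by
    rcases hab with hab | rfl
    · rcases hbc with hbc | rfl
      · exact Or.inl (degLexLT_trans hab hbc)
      · exact Or.inl hab
    · exact hbc⟩
  have hperm := List.perm_insertionSort r l
  have hsort : (l.insertionSort r).Pairwise r := List.pairwise_insertionSort r l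
  have key : f (l.insertionSort r) ∈
      W ⊔ Submodule.span k (f '' {s | IsStandard p lt s ∧ s.Perm l}) := by
    rcases pairwise_or_exists_repetition (p := p) hsort with h | ⟨l₁, l₂, v, e, hv⟩
    · exact Submodule.mem_sup_right (Submodule.subset_span
        ⟨_, ⟨⟨h, fun w hw => hl w (hperm.subset hw)⟩, hperm⟩, rfl⟩)
    · refine Submodule.mem_sup_left ?_
      rw [e]
      exact hodd l₁ l₂ v (e ▸ hperm) hv
  refine mem_of_perm (l := l) (fun l₁ l₂ a b h => ?_) hperm.symm [] (List.Perm.refl _) key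
  obtain ⟨c, hc⟩ := hswap l₁ l₂ a b h
  exact ⟨c, Submodule.mem_sup_left hc⟩

end Sorting

/-! ### A Poincaré–Birkhoff–Witt theorem in the free associative algebra -/

section FreeAlg

variable {k : Type*} [Field k] {n : ℕ} {p : Fin n → ZMod 2} {lt : LieWord n → LieWord n → Prop}

/-- The value of a bracket word in the free associative algebra, with the supercommutator as
bracket. -/
noncomputable def commEval (k : Type*) [Field k] {n : ℕ} (p : Fin n → ZMod 2) :
    LieWord n → FreeAlgebra k (Fin (n + 1))
  | .of x => FreeAlgebra.ι k x
  | u * v => commEval k p u * commEval k p v -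
      sign k (parity p u) (parity p v) • (commEval k p v * commEval k p u)

theorem commEval_mul (u v : LieWord n) : commEval k p (u * v) = commEval k p u * commEval k p v -
    sign k (parity p u) (parity p v) • (commEval k p v * commEval k p u) := rfl

/-- The parity automorphism of the free associative algebra. -/
noncomputable def parityAut (k : Type*) [Field k] {n : ℕ} (p : Fin n → ZMod 2) :
    FreeAlgebra k (Fin (n + 1)) →ₐ[k] FreeAlgebra k (Fin (n + 1)) :=
  FreeAlgebra.lift k fun x => sign k 1 (letterParity p x) • FreeAlgebra.ι k x

theorem parityAut_commEval (u : LieWord n) :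
    parityAut k p (commEval k p u) = sign k 1 (parity p u) • commEval k p u := by
  induction u with
  | of x => exact FreeAlgebra.lift_ι_apply _ _
  | mul u v hu hv =>
    change parityAut k p (commEval k p (u * v)) = sign k 1 (parity p (u * v)) • commEval k p (u * v)
    rw [commEval_mul, parity_mul, map_sub, map_smul, map_mul, map_mul, hu, hv, sign_add_right]
    simp only [smul_sub, smul_mul_assoc, mul_smul_comm, smul_smul]
    congr 2 <;> ring

/-- The supercommutator on the free associative algebra. -/
noncomputable def superComm (k : Type*) [Field k] {n : ℕ} (p : Fin n → ZMod 2) :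
    FreeAlgebra k (Fin (n + 1)) →ₗ[k] FreeAlgebra k (Fin (n + 1)) →ₗ[k]
      FreeAlgebra k (Fin (n + 1)) :=
  -- With σ the parity automorphism, (a ± σa)/2 are the even and odd parts of a, and moving an odd
  -- element past b turns b into σb. This makes the supercommutator bilinear without a case split on
  -- parities.
  LinearMap.mk₂ k (fun a b => a * b - (2⁻¹ : k) • (b * (a + parityAut k p a) +
      parityAut k p b * (a - parityAut k p a)))
    (fun a b c => by rw [map_add]; simp only [mul_add, mul_sub, add_mul, smul_add, smul_sub]; abel)
    (fun c a b => by
      rw [map_smul]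
      simp only [mul_add, mul_sub, smul_add, smul_sub, smul_mul_assoc, mul_smul_comm, smul_comm c])
    (fun a b c => by rw [map_add]; simp only [mul_add, mul_sub, add_mul, smul_add, smul_sub]; abel)
    (fun c a b => by
      rw [map_smul]
      simp only [mul_add, mul_sub, smul_add, smul_sub, smul_mul_assoc, mul_smul_comm, smul_comm c])

theorem sign_eq_one_or (i j : ZMod 2) : sign k i j = 1 ∨ sign k i j = -1 :=
  mul_self_eq_one_iff.1 (sign_mul_self k i j)

variable [CharZero k]

theorem superComm_commEval (u v : LieWord n) :
    superComm k p (commEval k p u) (commEval k p v) = commEval k p (u * v) := by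
  have h2 : (2⁻¹ : k) + 2⁻¹ = 1 := by norm_num
  rw [superComm, LinearMap.mk₂_apply, parityAut_commEval, parityAut_commEval, commEval_mul]
  rcases ZMod.two_eq_zero_or_one (parity p u) with hu | hu
  · rw [hu, sign_zero_left, sign_zero_right, one_smul, one_smul, sub_self, mul_zero, add_zero,
      mul_add, smul_add, ← add_smul, h2]
    simp only [one_smul]
  · rw [hu, sign_one_one, neg_one_smul, add_neg_cancel, mul_zero, zero_add, sub_neg_eq_add,
      mul_add, smul_add, ← add_smul, h2, one_smul, smul_mul_assoc]

theorem isSuperLieEval_commEval : IsSuperLieEval p (superComm k p) (commEval k p) where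
  mul u v := (superComm_commEval u v).symm
  anticomm u v := by
    rw [superComm_commEval, superComm_commEval, commEval_mul, commEval_mul, smul_sub, smul_smul,
      sign_comm k (parity p v), sign_mul_self, one_smul, neg_sub]
  jacobi u v w := by
    rw [superComm_commEval, superComm_commEval, superComm_commEval, superComm_commEval,
      superComm_commEval, superComm_commEval, commEval_mul, commEval_mul u, commEval_mul u (v * w),
      commEval_mul v w, commEval_mul v (u * w), commEval_mul u w, parity_mul, parity_mul,
      parity_mul, sign_add_left, sign_add_right, sign_add_right,
      sign_comm k (parity p v) (parity p u)]
    rcases sign_eq_one_or (k := k) (parity p u) (parity p v) with h₁ | h₁ <;>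
    rcases sign_eq_one_or (k := k) (parity p u) (parity p w) with h₂ | h₂ <;>
    rcases sign_eq_one_or (k := k) (parity p v) (parity p w) with h₃ | h₃ <;>
    rw [h₁, h₂, h₃] <;>
    simp only [mul_one, mul_neg, neg_neg, one_smul, neg_smul] <;>
    noncomm_ring

/-- The product in the free associative algebra of the values of a list of words. -/
noncomputable def prodEval (k : Type*) [Field k] {n : ℕ} (p : Fin n → ZMod 2)
    (l : List (LieWord n)) : FreeAlgebra k (Fin (n + 1)) := (l.map (commEval k p)).prod

omit [CharZero k] in
theorem prodEval_append (l₁ l₂ : List (LieWord n)) :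
    prodEval k p (l₁ ++ l₂) = prodEval k p l₁ * prodEval k p l₂ := by
  simp [prodEval]

omit [CharZero k] in
theorem prodEval_cons (w : LieWord n) (l : List (LieWord n)) :
    prodEval k p (w :: l) = commEval k p w * prodEval k p l := by
  simp [prodEval]

theorem totalLength_append (l₁ l₂ : List (LieWord n)) :
    totalLength (l₁ ++ l₂) = totalLength l₁ + totalLength l₂ := by
  simp [totalLength]

theorem totalLength_cons (w : LieWord n) (l : List (LieWord n)) :
    totalLength (w :: l) = w.length + totalLength l := by
  simp [totalLength]

/-- The span of the products of standard lists of at most `r` words with at most `d` letters. -/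
def standardSpan (k : Type*) [Field k] {n : ℕ} (p : Fin n → ZMod 2)
    (lt : LieWord n → LieWord n → Prop) (r d : ℕ) : Submodule k (FreeAlgebra k (Fin (n + 1))) :=
  Submodule.span k (prodEval k p '' {s | IsStandard p lt s ∧ s.length ≤ r ∧ totalLength s ≤ d})

omit [CharZero k] in
theorem standardSpan_mono {r r' d d' : ℕ} (hr : r ≤ r') (hd : d ≤ d') :
    standardSpan k p lt r d ≤ standardSpan k p lt r' d' :=
  Submodule.span_mono (Set.image_mono fun _ hs => ⟨hs.1, hs.2.1.trans hr, hs.2.2.trans hd⟩)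

theorem prodEval_mem_of_forall (hlt : IsAdmissibleOrder lt)
    {W : Submodule k (FreeAlgebra k (Fin (n + 1)))} {l₁ l₂ : List (LieWord n)} {u : LieWord n}
    (h : ∀ w, w ∈ shternSet p lt → w.length = u.length → prodEval k p (l₁ ++ w :: l₂) ∈ W) :
    prodEval k p l₁ * (commEval k p u * prodEval k p l₂) ∈ W := by
  have hu := (isSuperLieEval_commEval (k := k) (p := p)).mem_shternSpan hlt u
  have hle : shternSpan p lt k (commEval k p) u.length ≤ W.comap
      (LinearMap.mulLeft k (prodEval k p l₁) ∘ₗ LinearMap.mulRight k (prodEval k p l₂)) := by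
    rw [shternSpan, Submodule.span_le]
    rintro _ ⟨w, ⟨hw, hwl⟩, rfl⟩
    have := h w hw hwl
    rwa [prodEval_append, prodEval_cons] at this
  exact hle hu

/-- Straightening by induction on the number of factors. A transposition of a and b costs a product
with the single factor {a,b}, and v² = {v,v}/2 for an odd v. Both corrections have one factor fewer
and the same letters, and the new factor is rewritten in `M`. -/
theorem prodEval_mem_standardSpan (hlt : IsAdmissibleOrder lt) {l : List (LieWord n)}
    (hl : ∀ w ∈ l, w ∈ shternSet p lt) :
    prodEval k p l ∈ standardSpan k p lt l.length (totalLength l) := by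
  induction hr : l.length using Nat.strong_induction_on generalizing l with
  | _ r ih =>
  subst hr
  have lower : ∀ l₁ l₂ a b, (l₁ ++ a :: b :: l₂).Perm l →
      prodEval k p l₁ * (commEval k p (a * b) * prodEval k p l₂) ∈
        standardSpan k p lt (l.length - 1) (totalLength l) := by
    intro l₁ l₂ a b hperm
    have hlen := hperm.length_eq
    have htot : totalLength (l₁ ++ a :: b :: l₂) = totalLength l := (hperm.map _).sum_eq
    simp only [List.length_append, List.length_cons] at hlen
    refine prodEval_mem_of_forall hlt fun w hw hwl => ?_
    have hlen' : (l₁ ++ w :: l₂).length = l.length - 1 := by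
      simp only [List.length_append, List.length_cons]
      omega
    have htot' : totalLength (l₁ ++ w :: l₂) = totalLength l := by
      rw [← htot]
      simp only [totalLength_append, totalLength_cons, hwl, length_mul]
      omega
    have := ih _ (by omega) (l := l₁ ++ w :: l₂) ?_ hlen'
    · rwa [htot'] at this
    · intro z hz
      have hsub : ∀ y, y ∈ l₁ ∨ y ∈ l₂ → y ∈ shternSet p lt := fun y hy =>
        hl y (hperm.subset (by
          rcases hy with hy | hy
          · exact List.mem_append_left _ hy
          · exact List.mem_append_right _ (List.mem_cons_of_mem _ (List.mem_cons_of_mem _ hy))))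
      rcases List.mem_append.1 hz with hz | hz
      · exact hsub z (Or.inl hz)
      · rcases List.mem_cons.1 hz with rfl | hz
        · exact hw
        · exact hsub z (Or.inr hz)
  have hsort := mem_sup_span_isStandard (f := prodEval k p)
    (W := standardSpan k p lt (l.length - 1) (totalLength l)) hl ?_ ?_
  · refine (sup_le (standardSpan_mono (Nat.sub_le _ _) le_rfl)
      (Submodule.span_mono (Set.image_mono ?_)) : _ ≤ standardSpan k p lt l.length _) hsort
    rintro s ⟨hs, hperm⟩
    exact ⟨hs, hperm.length_eq.le, ((hperm.map _).sum_eq).le⟩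
  · intro l₁ l₂ a b hperm
    refine ⟨sign k (parity p a) (parity p b), ?_⟩
    convert lower l₁ l₂ a b hperm using 1
    simp only [prodEval_append, prodEval_cons, commEval_mul, sub_mul, mul_sub, smul_mul_assoc,
      mul_smul_comm, mul_assoc]
  · intro l₁ l₂ v hperm hv
    have h := lower l₁ l₂ v v hperm
    have e : prodEval k p l₁ * (commEval k p (v * v) * prodEval k p l₂) =
        (2 : k) • prodEval k p (l₁ ++ v :: v :: l₂) := by
      rw [commEval_mul, hv, sign_one_one, neg_one_smul, sub_neg_eq_add, prodEval_append,
        prodEval_cons, prodEval_cons, two_smul]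
      noncomm_ring
    rw [e] at h
    exact (Submodule.smul_mem_iff _ two_ne_zero).1 h

/-- Products of arbitrary bracket words are combinations of products of standard lists. -/
theorem prodEval_mem_standardSpan_of_list (hlt : IsAdmissibleOrder lt) (l : List (LieWord n)) :
    prodEval k p l ∈ standardSpan k p lt l.length (totalLength l) := by
  suffices H : ∀ l₁ : List (LieWord n), (∀ w ∈ l₁, w ∈ shternSet p lt) →
      prodEval k p (l₁ ++ l) ∈
        standardSpan k p lt (l₁ ++ l).length (totalLength (l₁ ++ l)) from
    H [] fun w hw => (List.not_mem_nil hw).elim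
  induction l with
  | nil =>
    intro l₁ hl₁
    rw [List.append_nil]
    exact prodEval_mem_standardSpan hlt hl₁
  | cons u l ih =>
    intro l₁ hl₁
    rw [prodEval_append, prodEval_cons]
    refine prodEval_mem_of_forall hlt fun w hw hwl => ?_
    have := ih (l₁ ++ [w]) (by
      intro z hz
      rcases List.mem_append.1 hz with hz | hz
      · exact hl₁ z hz
      · rw [List.mem_singleton.1 hz]
        exact hw)
    simp only [List.append_assoc, List.singleton_append, totalLength_append, totalLength_cons,
      List.length_append, List.length_cons, hwl] at this ⊢
    exact this

omit [CharZero k] in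
theorem linearIndependent_prod_ι :
    LinearIndependent k fun w : List (Fin (n + 1)) => (w.map (FreeAlgebra.ι k)).prod := by
  let φ : FreeAlgebra k (Fin (n + 1)) →ₐ[k] MonoidAlgebra k (FreeMonoid (Fin (n + 1))) :=
    FreeAlgebra.lift k fun x => MonoidAlgebra.of k _ (FreeMonoid.of x)
  have hφ : ∀ w : List (Fin (n + 1)), φ (w.map (FreeAlgebra.ι k)).prod =
      MonoidAlgebra.of k (FreeMonoid (Fin (n + 1))) (FreeMonoid.ofList w) := by
    intro w
    induction w with
    | nil => exact map_one φ
    | cons x w ih =>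
      rw [List.map_cons, List.prod_cons, map_mul, ih, FreeMonoid.ofList_cons, map_mul,
        FreeAlgebra.lift_ι_apply]
  refine LinearIndependent.of_comp
    ((MonoidAlgebra.coeffLinearEquiv k).toLinearMap ∘ₗ φ.toLinearMap) ?_
  have h := Finsupp.linearIndependent_single_one k (FreeMonoid (Fin (n + 1)))
  convert h.comp FreeMonoid.ofList FreeMonoid.ofList.injective using 1
  funext w
  change (MonoidAlgebra.coeffLinearEquiv k) (φ (w.map (FreeAlgebra.ι k)).prod) = _
  rw [hφ]
  rfl

/-- The products of standard lists are linearly independent in the free associative algebra. -/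
theorem linearIndependent_prodEval (hlt : IsAdmissibleOrder lt) :
    LinearIndependent k fun s : {s : List (LieWord n) // IsStandard p lt s} =>
      prodEval k p s.1 := by
  obtain ⟨f, hf, hfl⟩ := exists_injOn_isStandard p hlt
  have bounded : ∀ d, LinearIndependent k
      fun s : {s : List (LieWord n) // IsStandard p lt s ∧ totalLength s ≤ d} =>
        prodEval k p s.1 := by
    intro d
    let g : {s : List (LieWord n) // IsStandard p lt s ∧ totalLength s ≤ d} →
        {w : List (Fin (n + 1)) // w.length ≤ d} :=
      fun s => ⟨f s.1, (hfl s.1 s.2.1).trans_le s.2.2⟩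
    have hg : Function.Injective g := fun s t h =>
      Subtype.ext (hf s.2.1 t.2.1 (congrArg Subtype.val h))
    have : Fintype {w : List (Fin (n + 1)) // w.length ≤ d} :=
      (List.finite_length_le (Fin (n + 1)) d).fintype
    have : Fintype {s : List (LieWord n) // IsStandard p lt s ∧ totalLength s ≤ d} :=
      Fintype.ofInjective g hg
    -- It suffices that the family is no larger than the dimension of its span. The encoding bounds
    -- its size by the number of letter words of length at most d, and these words are independent
    -- and lie in the span.
    rw [linearIndependent_iff_card_le_finrank_span]
    refine (Fintype.card_le_of_injective g hg).trans ?_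
    have hli := (linearIndependent_prod_ι (k := k) (n := n)).comp
      (Subtype.val : {w : List (Fin (n + 1)) // w.length ≤ d} → _) Subtype.val_injective
    rw [← finrank_span_eq_card hli]
    have := Module.Finite.span_of_finite k (Set.finite_range
      fun s : {s : List (LieWord n) // IsStandard p lt s ∧ totalLength s ≤ d} => prodEval k p s.1)
    refine Submodule.finrank_mono ?_
    rw [Submodule.span_le]
    rintro _ ⟨⟨w, hw⟩, rfl⟩
    -- A letter word is a product of bracket words of length one, so it straightens without gaining
    -- letters.
    have h := prodEval_mem_standardSpan_of_list (k := k) (p := p) hlt (w.map FreeMagma.of)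
    have e : prodEval k p (w.map FreeMagma.of) = (w.map (FreeAlgebra.ι k)).prod := by
      rw [prodEval, List.map_map]
      rfl
    have e' : totalLength (w.map FreeMagma.of) = w.length := by
      rw [totalLength, List.map_map]
      simp [Function.comp_def]
    rw [e, e'] at h
    refine (Submodule.span_mono ?_ : standardSpan k p lt _ _ ≤ _) h
    rintro _ ⟨s, ⟨hs, -, hsl⟩, rfl⟩
    exact ⟨⟨s, hs, hsl.trans hw⟩, rfl⟩
  rw [linearIndependent_iff_finset_linearIndependent]
  intro J
  obtain ⟨d, hd⟩ : ∃ d, ∀ s ∈ J, totalLength s.1 ≤ d :=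
    ⟨J.sup fun s => totalLength s.1, fun s hs => Finset.le_sup (f := fun s => totalLength s.1) hs⟩
  exact (bounded d).comp (fun s : J => ⟨s.1.1, s.1.2, hd s.1 s.2⟩) fun s t h =>
    Subtype.ext (Subtype.ext (Subtype.mk.inj h))

end FreeAlg

end LieWord

/-! ### The filtration by the number of bracket factors -/

namespace LieWord

open FreeDialgebra

section LengthFiltration

variable {k : Type*} [Field k] {n : ℕ} {p : Fin n → ZMod 2}

/-- The parity of a product of a list of words. -/
def listParity (p : Fin n → ZMod 2) (l : List (LieWord n)) : ZMod 2 := (l.map (parity p)).sum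

theorem listParity_cons (u : LieWord n) (l : List (LieWord n)) :
    listParity p (u :: l) = parity p u + listParity p l := by
  simp [listParity]

theorem listParity_append (l₁ l₂ : List (LieWord n)) :
    listParity p (l₁ ++ l₂) = listParity p l₁ + listParity p l₂ := by
  simp [listParity]

/-- The span of the products of fewer than `m` values of bracket words, of total parity `i`. -/
def lengthFiltration (k : Type*) [Field k] {n : ℕ} (p : Fin n → ZMod 2) (i : ZMod 2) (m : ℕ) :
    Submodule k (FreeAlgebra k (Fin (n + 1))) :=
  Submodule.span k (prodEval k p '' {l | l.length < m ∧ listParity p l = i})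

theorem prodEval_mem_lengthFiltration {l : List (LieWord n)} {m : ℕ} {i : ZMod 2}
    (hm : l.length < m) (hi : listParity p l = i) : prodEval k p l ∈ lengthFiltration k p i m :=
  Submodule.subset_span ⟨l, ⟨hm, hi⟩, rfl⟩

theorem lengthFiltration_mono (i : ZMod 2) {m m' : ℕ} (h : m ≤ m') :
    lengthFiltration k p i m ≤ lengthFiltration k p i m' :=
  Submodule.span_mono (Set.image_mono fun _ hl => ⟨hl.1.trans_le h, hl.2⟩)

/-- The strict bound on the number of factors makes this step trivial; this is what makes
supercommutators of series divisible by X. -/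
theorem lengthFiltration_zero (i : ZMod 2) : lengthFiltration k p i 0 = ⊥ := by
  rw [lengthFiltration, Submodule.span_eq_bot]
  rintro _ ⟨l, ⟨hl, -⟩, rfl⟩
  exact absurd hl (Nat.not_lt_zero _)

theorem mul_mem_lengthFiltration {i j : ZMod 2} {m r : ℕ} {a b : FreeAlgebra k (Fin (n + 1))}
    (ha : a ∈ lengthFiltration k p i m) (hb : b ∈ lengthFiltration k p j r) :
    a * b ∈ lengthFiltration k p (i + j) (m + r - 1) := by
  refine Submodule.span_induction₂ (p := fun a b _ _ => a * b ∈ lengthFiltration k p (i + j) _)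
    ?_ ?_ ?_ ?_ ?_ ?_ ?_ ha hb
  · rintro _ _ ⟨l, ⟨hl, rfl⟩, rfl⟩ ⟨l', ⟨hl', rfl⟩, rfl⟩
    rw [← prodEval_append]
    refine prodEval_mem_lengthFiltration ?_ (listParity_append _ _)
    rw [List.length_append]
    omega
  · intro b _
    rw [zero_mul]
    exact zero_mem _
  · intro a _
    rw [mul_zero]
    exact zero_mem _
  · intro a a' b _ _ _ h h'
    rw [add_mul]
    exact add_mem h h'
  · intro a b b' _ _ _ h h'
    rw [mul_add]
    exact add_mem h h'
  · intro c a b _ _ h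
    rw [smul_mul_assoc]
    exact Submodule.smul_mem _ _ h
  · intro c a b _ _ h
    rw [mul_smul_comm]
    exact Submodule.smul_mem _ _ h

theorem commEval_mem_lengthFiltration (u : LieWord n) :
    commEval k p u ∈ lengthFiltration k p (parity p u) 2 := by
  have := prodEval_mem_lengthFiltration (k := k) (p := p) (l := [u]) (m := 2) (by simp) rfl
  simpa [prodEval, listParity] using this

/-- The supercommutator with u is a superderivation: each term replaces some factor v by {u,v} and
leaves the number of factors in l unchanged. -/
theorem commEval_comm_mem (u : LieWord n) (l : List (LieWord n)) :
    commEval k p u * prodEval k p l - sign k (parity p u) (listParity p l) •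
      (prodEval k p l * commEval k p u) ∈
        lengthFiltration k p (parity p u + listParity p l) (l.length + 1) := by
  induction l with
  | nil =>
    have : commEval k p u * prodEval k p [] - sign k (parity p u) (listParity p []) •
        (prodEval k p [] * commEval k p u) = 0 := by
      simp [prodEval, listParity, sign_zero_right]
    rw [this]
    exact zero_mem _
  | cons v l ih =>
    have e : commEval k p u * prodEval k p (v :: l) -
        sign k (parity p u) (listParity p (v :: l)) • (prodEval k p (v :: l) * commEval k p u) =
        prodEval k p (u * v :: l) + sign k (parity p u) (parity p v) • (commEval k p v *
          (commEval k p u * prodEval k p l - sign k (parity p u) (listParity p l) •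
            (prodEval k p l * commEval k p u))) := by
      rw [prodEval_cons, prodEval_cons, commEval_mul, listParity_cons, sign_add_right]
      simp only [mul_sub, sub_mul, smul_sub, mul_smul_comm, smul_mul_assoc, smul_smul, mul_assoc]
      abel
    rw [e]
    refine add_mem ?_ (Submodule.smul_mem _ _ ?_)
    · refine prodEval_mem_lengthFiltration ?_ ?_
      · simp
      · rw [listParity_cons, listParity_cons, parity_mul, add_assoc]
    · have := mul_mem_lengthFiltration (commEval_mem_lengthFiltration (k := k) (p := p) v) ih
      rw [listParity_cons, add_left_comm]
      exact lengthFiltration_mono _ (by simp only [List.length_cons]; omega) this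

theorem prodEval_comm_mem (l l' : List (LieWord n)) :
    prodEval k p l * prodEval k p l' - sign k (listParity p l) (listParity p l') •
      (prodEval k p l' * prodEval k p l) ∈
        lengthFiltration k p (listParity p l + listParity p l') (l.length + l'.length) := by
  induction l with
  | nil =>
    have : prodEval k p [] * prodEval k p l' - sign k (listParity p []) (listParity p l') •
        (prodEval k p l' * prodEval k p []) = 0 := by
      simp [prodEval, listParity, sign_zero_left]
    rw [this]
    exact zero_mem _
  | cons u l ih =>
    have e : prodEval k p (u :: l) * prodEval k p l' -
        sign k (listParity p (u :: l)) (listParity p l') •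
          (prodEval k p l' * prodEval k p (u :: l)) =
        commEval k p u * (prodEval k p l * prodEval k p l' -
          sign k (listParity p l) (listParity p l') • (prodEval k p l' * prodEval k p l)) +
        sign k (listParity p l) (listParity p l') • ((commEval k p u * prodEval k p l' -
          sign k (parity p u) (listParity p l') • (prodEval k p l' * commEval k p u)) *
            prodEval k p l) := by
      rw [prodEval_cons, listParity_cons, sign_add_left]
      simp only [mul_sub, sub_mul, smul_sub, mul_smul_comm, smul_mul_assoc, smul_smul, mul_assoc,
        mul_comm (sign k (parity p u) _)]
      abel
    rw [e]
    refine add_mem ?_ (Submodule.smul_mem _ _ ?_)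
    · have := mul_mem_lengthFiltration (commEval_mem_lengthFiltration (k := k) (p := p) u) ih
      rw [listParity_cons, add_assoc]
      exact lengthFiltration_mono _ (by simp only [List.length_cons]; omega) this
    · have := mul_mem_lengthFiltration (commEval_comm_mem (k := k) (p := p) u l')
        (prodEval_mem_lengthFiltration (Nat.lt_succ_self l.length) rfl)
      rw [listParity_cons, add_right_comm]
      exact lengthFiltration_mono _ (by simp only [List.length_cons]; omega) this

theorem comm_mem_lengthFiltration {i j : ZMod 2} {m r : ℕ} {a b : FreeAlgebra k (Fin (n + 1))}
    (ha : a ∈ lengthFiltration k p i m) (hb : b ∈ lengthFiltration k p j r) :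
    a * b - sign k i j • (b * a) ∈ lengthFiltration k p (i + j) (m + r - 2) := by
  refine Submodule.span_induction₂ (p := fun a b _ _ => a * b - sign k i j • (b * a) ∈
    lengthFiltration k p (i + j) _) ?_ ?_ ?_ ?_ ?_ ?_ ?_ ha hb
  · rintro _ _ ⟨l, ⟨hl, rfl⟩, rfl⟩ ⟨l', ⟨hl', rfl⟩, rfl⟩
    exact lengthFiltration_mono _ (by omega) (prodEval_comm_mem l l')
  · intro b _
    simp
  · intro a _
    simp
  · intro a a' b _ _ _ h h'
    convert add_mem h h' using 1
    rw [add_mul, mul_add, smul_add]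
    abel
  · intro a b b' _ _ _ h h'
    convert add_mem h h' using 1
    rw [add_mul, mul_add, smul_add]
    abel
  · intro c a b _ _ h
    convert Submodule.smul_mem _ c h using 1
    rw [smul_mul_assoc, mul_smul_comm, smul_sub, smul_comm]
  · intro c a b _ _ h
    convert Submodule.smul_mem _ c h using 1
    rw [smul_mul_assoc, mul_smul_comm, smul_sub, smul_comm]

end LengthFiltration

/-! ### The semiclassical bracket on power series -/

section Series

variable {k : Type*} [Field k] {n : ℕ} {p : Fin n → ZMod 2}

/-- Power series over the free associative algebra. -/
abbrev WordSeries (k : Type*) [Field k] (n : ℕ) : Type _ :=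
  PowerSeries (FreeAlgebra k (Fin (n + 1)))

/-- The series of parity `i` whose coefficient of degree `m` is a combination of products of fewer
than `m + e` bracket words. -/
def seriesFiltration (k : Type*) [Field k] {n : ℕ} (p : Fin n → ZMod 2) (i : ZMod 2) (e : ℕ) :
    Submodule k (WordSeries k n) where
  carrier := {q | ∀ m, PowerSeries.coeff m q ∈ lengthFiltration k p i (m + e)}
  add_mem' ha hb m := by
    rw [map_add]
    exact add_mem (ha m) (hb m)
  zero_mem' m := by
    rw [map_zero]
    exact zero_mem _
  smul_mem' c q hq m := by
    rw [PowerSeries.coeff_smul]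
    exact Submodule.smul_mem _ _ (hq m)

theorem mul_mem_seriesFiltration {i j : ZMod 2} {e e' : ℕ} {a b : WordSeries k n}
    (ha : a ∈ seriesFiltration k p i e) (hb : b ∈ seriesFiltration k p j e') :
    a * b ∈ seriesFiltration k p (i + j) (e + e' - 1) := by
  intro m
  rw [PowerSeries.coeff_mul]
  refine sum_mem fun x hx => ?_
  have hx := Finset.HasAntidiagonal.mem_antidiagonal.1 hx
  exact lengthFiltration_mono _ (by omega) (mul_mem_lengthFiltration (ha x.1) (hb x.2))

theorem coeff_comm_mem {i j : ZMod 2} {e e' : ℕ} {a b : WordSeries k n}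
    (ha : a ∈ seriesFiltration k p i e) (hb : b ∈ seriesFiltration k p j e') (m : ℕ) :
    PowerSeries.coeff m (a * b - sign k i j • (b * a)) ∈
      lengthFiltration k p (i + j) (m + e + e' - 2) := by
  rw [map_sub, PowerSeries.coeff_smul, PowerSeries.coeff_mul, PowerSeries.coeff_mul,
    ← Finset.Nat.sum_antidiagonal_swap (n := m) (f := fun x => PowerSeries.coeff x.1 b * _),
    Finset.smul_sum, ← Finset.sum_sub_distrib]
  refine sum_mem fun x hx => ?_
  have hx := Finset.HasAntidiagonal.mem_antidiagonal.1 hx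
  exact lengthFiltration_mono _ (by omega) (comm_mem_lengthFiltration (ha x.1) (hb x.2))

theorem comm_mem_seriesFiltration {i j : ZMod 2} {a b : WordSeries k n}
    (ha : a ∈ seriesFiltration k p i 1) (hb : b ∈ seriesFiltration k p j 1) :
    a * b - sign k i j • (b * a) ∈ seriesFiltration k p (i + j) 0 :=
  fun m => coeff_comm_mem ha hb m

/-- Division of a power series by the variable. -/
noncomputable def divX (k : Type*) [Field k] (n : ℕ) : WordSeries k n →ₗ[k] WordSeries k n where
  toFun q := PowerSeries.mk fun m => PowerSeries.coeff (m + 1) q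
  map_add' a b := by ext m; simp
  map_smul' c a := by ext m; simp

theorem coeff_divX (m : ℕ) (q : WordSeries k n) :
    PowerSeries.coeff m (divX k n q) = PowerSeries.coeff (m + 1) q := by
  simp [divX]

theorem X_mul_cancel {a b : WordSeries k n}
    (h : (PowerSeries.X : WordSeries k n) * a = PowerSeries.X * b) : a = b := by
  ext m
  rw [← PowerSeries.coeff_succ_X_mul, h, PowerSeries.coeff_succ_X_mul]

theorem mul_X_mul (a b : WordSeries k n) :
    a * (PowerSeries.X * b) = (PowerSeries.X : WordSeries k n) * (a * b) := by
  rw [← mul_assoc, ← mul_assoc, PowerSeries.X_mul]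

/-- The semiclassical bracket of series, for a given sign. -/
noncomputable def seriesBracket (s : k) (a b : WordSeries k n) : WordSeries k n :=
  divX k n (a * b - s • (b * a))

/-- The constant coefficient of the supercommutator lies in the zero step of the filtration, so
`divX` loses nothing. -/
theorem X_mul_seriesBracket {i j : ZMod 2} {a b : WordSeries k n}
    (ha : a ∈ seriesFiltration k p i 1) (hb : b ∈ seriesFiltration k p j 1) :
    (PowerSeries.X : WordSeries k n) * seriesBracket (sign k i j) a b =
      a * b - sign k i j • (b * a) := by
  ext m
  cases m with
  | zero =>
    have h := coeff_comm_mem ha hb 0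
    rw [lengthFiltration_zero, Submodule.mem_bot] at h
    rw [PowerSeries.coeff_zero_X_mul, h]
  | succ m => rw [PowerSeries.coeff_succ_X_mul, seriesBracket, coeff_divX]

/-- The factor lost in a supercommutator offsets the degree lost on dividing by X. Hence level 1 is
closed under the bracket, and bracketing level 1 with level 0 stays in level 0. -/
theorem seriesBracket_mem {i j : ZMod 2} {e e' : ℕ} {a b : WordSeries k n}
    (ha : a ∈ seriesFiltration k p i e) (hb : b ∈ seriesFiltration k p j e') :
    seriesBracket (sign k i j) a b ∈ seriesFiltration k p (i + j) (e + e' - 1) := by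
  intro m
  rw [seriesBracket, coeff_divX]
  exact lengthFiltration_mono _ (by omega) (coeff_comm_mem ha hb (m + 1))

theorem seriesBracket_anticomm (i j : ZMod 2) (a b : WordSeries k n) :
    seriesBracket (sign k i j) a b + sign k i j • seriesBracket (sign k j i) b a = 0 := by
  rw [seriesBracket, seriesBracket, ← map_smul, ← map_add, smul_sub, smul_smul, sign_comm k j i,
    sign_mul_self, one_smul, sub_add_sub_cancel, sub_self, map_zero]

/-- After multiplication by X² this is the Jacobi identity for supercommutators, so it holds exactly
and not merely modulo negligible series. -/
theorem seriesBracket_jacobi {i j l : ZMod 2} {a b c : WordSeries k n}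
    (ha : a ∈ seriesFiltration k p i 1) (hb : b ∈ seriesFiltration k p j 1)
    (hc : c ∈ seriesFiltration k p l 1) :
    seriesBracket (sign k (i + j) l) (seriesBracket (sign k i j) a b) c +
      sign k i j • seriesBracket (sign k j (i + l)) b (seriesBracket (sign k i l) a c) -
      seriesBracket (sign k i (j + l)) a (seriesBracket (sign k j l) b c) = 0 := by
  have hab := X_mul_seriesBracket ha hb
  have hac := X_mul_seriesBracket ha hc
  have hbc := X_mul_seriesBracket hb hc
  have mab := seriesBracket_mem ha hb
  have mac := seriesBracket_mem ha hc
  have mbc := seriesBracket_mem hb hc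
  have h1 := X_mul_seriesBracket mab hc
  have h2 := X_mul_seriesBracket hb mac
  have h3 := X_mul_seriesBracket ha mbc
  have key : ∀ (s : k) (q r : WordSeries k n),
      (PowerSeries.X : WordSeries k n) * (q * r - s • (r * q)) =
        (PowerSeries.X * q) * r - s • (r * (PowerSeries.X * q)) := by
    intro s q r
    rw [mul_sub, mul_smul_comm, mul_X_mul, mul_assoc]
  have key' : ∀ (s : k) (q r : WordSeries k n),
      (PowerSeries.X : WordSeries k n) * (r * q - s • (q * r)) =
        r * (PowerSeries.X * q) - s • ((PowerSeries.X * q) * r) := by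
    intro s q r
    rw [mul_sub, mul_smul_comm, mul_X_mul, mul_assoc]
  apply X_mul_cancel
  apply X_mul_cancel
  rw [mul_zero, mul_zero, mul_sub, mul_add, mul_smul_comm, h1, h2, h3, mul_sub, mul_add,
    mul_smul_comm, key, key', key', hab, hac, hbc, sign_add_left, sign_add_right,
    sign_add_right, sign_comm k j i]
  rcases sign_eq_one_or (k := k) i j with h₁ | h₁ <;>
  rcases sign_eq_one_or (k := k) i l with h₂ | h₂ <;>
  rcases sign_eq_one_or (k := k) j l with h₃ | h₃ <;>
  rw [h₁, h₂, h₃] <;>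
  simp only [mul_one, mul_neg, neg_neg, one_smul, neg_smul] <;>
  noncomm_ring

/-- The series that replaces the unit: `1 + t X`, where `t` is the letter `1`. -/
noncomputable def unitSeries (k : Type*) [Field k] (n : ℕ) : WordSeries k n :=
  1 + PowerSeries.X * PowerSeries.C (FreeAlgebra.ι k 0)

/-- The inverse of `unitSeries`. -/
noncomputable def unitSeriesInv (k : Type*) [Field k] (n : ℕ) : WordSeries k n :=
  PowerSeries.mk fun m => (-FreeAlgebra.ι k 0) ^ m

theorem unitSeries_mul_inv : unitSeries k n * unitSeriesInv k n = 1 := by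
  ext m
  rw [unitSeries, add_mul, one_mul, map_add, mul_assoc]
  cases m with
  | zero => simp [unitSeriesInv]
  | succ m =>
    rw [PowerSeries.coeff_succ_X_mul, PowerSeries.coeff_C_mul, unitSeriesInv, PowerSeries.coeff_mk,
      PowerSeries.coeff_mk, PowerSeries.coeff_one, if_neg m.succ_ne_zero, pow_succ']
    noncomm_ring

theorem unitSeriesInv_mul : unitSeriesInv k n * unitSeries k n = 1 := by
  ext m
  rw [unitSeries, mul_add, mul_one, map_add, mul_X_mul]
  cases m with
  | zero => simp [unitSeriesInv]
  | succ m =>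
    rw [PowerSeries.coeff_succ_X_mul, PowerSeries.coeff_mul_C, unitSeriesInv, PowerSeries.coeff_mk,
      PowerSeries.coeff_mk, PowerSeries.coeff_one, if_neg m.succ_ne_zero, pow_succ]
    noncomm_ring

theorem one_mem_seriesFiltration : (1 : WordSeries k n) ∈ seriesFiltration k p 0 1 := by
  intro m
  rw [PowerSeries.coeff_one]
  split_ifs with h
  · have := prodEval_mem_lengthFiltration (k := k) (p := p) (l := []) (m := m + 1) (by simp) rfl
    simpa [prodEval, listParity] using this
  · exact zero_mem _

theorem X_mul_C_mem_seriesFiltration (u : LieWord n) :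
    PowerSeries.X * PowerSeries.C (commEval k p u) ∈ seriesFiltration k p (parity p u) 1 := by
  intro m
  cases m with
  | zero =>
    rw [PowerSeries.coeff_zero_X_mul]
    exact zero_mem _
  | succ m =>
    rw [PowerSeries.coeff_succ_X_mul, PowerSeries.coeff_C]
    split_ifs with h
    · subst h
      exact commEval_mem_lengthFiltration u
    · exact zero_mem _

theorem unitSeries_mem : unitSeries k n ∈ seriesFiltration k p 0 1 :=
  add_mem one_mem_seriesFiltration (X_mul_C_mem_seriesFiltration (FreeMagma.of 0))

theorem unitSeriesInv_mem : unitSeriesInv k n ∈ seriesFiltration k p 0 1 := by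
  intro m
  rw [unitSeriesInv, PowerSeries.coeff_mk]
  have h := prodEval_mem_lengthFiltration (k := k) (p := p)
    (l := List.replicate m (FreeMagma.of 0)) (m := m + 1) (by simp) rfl
  have h0 : listParity p (List.replicate m (FreeMagma.of 0 : LieWord n)) = 0 := by
    rw [listParity, List.map_replicate]
    have : parity p (FreeMagma.of 0) = 0 := rfl
    rw [this, List.sum_replicate, smul_zero]
  have h1 : prodEval k p (List.replicate m (FreeMagma.of 0)) =
      (FreeAlgebra.ι k 0 : FreeAlgebra k (Fin (n + 1))) ^ m := by
    rw [prodEval, List.map_replicate, List.prod_replicate]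
    rfl
  rw [h0, h1] at h
  rw [neg_pow]
  rcases neg_one_pow_eq_or (FreeAlgebra k (Fin (n + 1))) m with e | e <;> rw [e]
  · rwa [one_mul]
  · rw [neg_one_mul]
    exact neg_mem h

end Series

end LieWord

namespace LieWord

open FreeDialgebra

variable {k : Type*} [Field k] {n : ℕ} {p : Fin n → ZMod 2}

theorem mul_mem_seriesFiltration_right {i j : ZMod 2} {e : ℕ} {a b : WordSeries k n}
    (ha : a ∈ seriesFiltration k p i e) (hb : b ∈ seriesFiltration k p j 1) :
    a * b ∈ seriesFiltration k p (i + j) e := by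
  have := mul_mem_seriesFiltration ha hb
  rwa [Nat.add_sub_cancel] at this

theorem mul_mem_seriesFiltration_left {i j : ZMod 2} {e : ℕ} {a b : WordSeries k n}
    (ha : a ∈ seriesFiltration k p i 1) (hb : b ∈ seriesFiltration k p j e) :
    a * b ∈ seriesFiltration k p (i + j) e := by
  have := mul_mem_seriesFiltration ha hb
  rwa [Nat.add_sub_cancel_left] at this

theorem mul_unitSeriesInv_mem {i : ZMod 2} {e : ℕ} {a : WordSeries k n}
    (ha : a ∈ seriesFiltration k p i e) : a * unitSeriesInv k n ∈ seriesFiltration k p i e := by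
  have := mul_mem_seriesFiltration_right ha (unitSeriesInv_mem (p := p))
  rwa [add_zero] at this

/-- With τ the unit series and ρ its inverse, the Leibniz rule for the commutator applied to bcρ
produces the extra term -bcρ{a,τ}ρ, which is the D-term up to reordering of factors. Reordering is
free modulo level 0. -/
theorem seriesBracket_leibniz {i j l : ZMod 2} {a b c : WordSeries k n}
    (ha : a ∈ seriesFiltration k p i 1) (hb : b ∈ seriesFiltration k p j 1)
    (hc : c ∈ seriesFiltration k p l 1) :
    seriesBracket (sign k i j) a b * c * unitSeriesInv k n +
      sign k i j • (b * seriesBracket (sign k i l) a c * unitSeriesInv k n) -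
      seriesBracket (sign k i 0) a (unitSeries k n) * b * unitSeriesInv k n * c *
        unitSeriesInv k n -
      seriesBracket (sign k i (j + l)) a (b * c * unitSeriesInv k n) ∈
        seriesFiltration k p (i + j + l) 0 := by
  have hbc := mul_unitSeriesInv_mem (mul_mem_seriesFiltration_left hb hc)
  have hD := seriesBracket_mem ha (unitSeries_mem (k := k) (p := p))
  have eab := X_mul_seriesBracket ha hb
  have eac := X_mul_seriesBracket ha hc
  have eD := X_mul_seriesBracket ha (unitSeries_mem (k := k) (p := p))
  have eZ := X_mul_seriesBracket ha hbc
  rw [add_zero] at hD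
  have hcomm := comm_mem_seriesFiltration hD hbc
  have hρc := comm_mem_seriesFiltration (unitSeriesInv_mem (k := k) (p := p)) hc
  have hτρ := unitSeries_mul_inv (k := k) (n := n)
  have hρτ := unitSeriesInv_mul (k := k) (n := n)
  rw [sign_zero_left, one_smul] at hρc
  rw [sign_zero_right, one_smul] at eD
  rw [sign_add_right] at eZ hcomm
  rw [sign_add_right, sign_zero_right]
  rw [sign_zero_right] at hD hcomm
  generalize seriesBracket (sign k i j) a b = P at *
  generalize seriesBracket (sign k i l) a c = Q at *
  generalize seriesBracket 1 a (unitSeries k n) = D at *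
  generalize seriesBracket (sign k i j * sign k i l) a (b * c * unitSeriesInv k n) = Z at *
  -- The exact error: one supercommutator moves D past bcρ, the other moves ρ past c.
  have hmem : (-((D * (b * c * unitSeriesInv k n) -
        (sign k i j * sign k i l) • (b * c * unitSeriesInv k n * D)) * unitSeriesInv k n) -
      D * b * (unitSeriesInv k n * c - c * unitSeriesInv k n) * unitSeriesInv k n) ∈
        seriesFiltration k p (i + j + l) 0 := by
    refine sub_mem (neg_mem (mul_unitSeriesInv_mem ?_)) (mul_unitSeriesInv_mem ?_)
    · rwa [← add_assoc] at hcomm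
    · rw [zero_add] at hρc
      exact mul_mem_seriesFiltration_left (mul_mem_seriesFiltration_left hD hb) hρc
  convert hmem using 1
  generalize unitSeries k n = τ at *
  generalize unitSeriesInv k n = ρ at *
  apply X_mul_cancel
  have e1 : (PowerSeries.X : WordSeries k n) * (P * c * ρ + sign k i j • (b * Q * ρ) -
      D * b * ρ * c * ρ - Z) = (PowerSeries.X * P) * c * ρ +
        sign k i j • (b * (PowerSeries.X * Q) * ρ) - (PowerSeries.X * D) * b * ρ * c * ρ -
        PowerSeries.X * Z := by
    rw [mul_X_mul b Q]
    simp only [mul_add, mul_sub, mul_smul_comm, mul_assoc]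
  have e2 : (PowerSeries.X : WordSeries k n) * (-((D * (b * c * ρ) -
        (sign k i j * sign k i l) • (b * c * ρ * D)) * ρ) - D * b * (ρ * c - c * ρ) * ρ) =
      (sign k i j * sign k i l) • (b * c * ρ * (PowerSeries.X * D) * ρ) -
        (PowerSeries.X * D) * b * ρ * c * ρ := by
    rw [mul_X_mul (b * c * ρ) D]
    simp only [sub_mul, mul_sub, mul_smul_comm, smul_mul_assoc, mul_assoc, neg_sub]
    abel
  -- The derivative of an inverse: ρ[a,τ]ρ = -[a,ρ].
  have e3 : b * c * ρ * (a * τ - τ * a) * ρ = b * c * ρ * a - b * c * a * ρ := by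
    calc b * c * ρ * (a * τ - τ * a) * ρ = b * c * ρ * a * (τ * ρ) - b * c * (ρ * τ) * a * ρ := by
          noncomm_ring
      _ = _ := by rw [hτρ, hρτ, mul_one, mul_one]
  rw [e1, e2, eab, eac, eZ, eD, e3]
  rcases sign_eq_one_or (k := k) i j with h₁ | h₁ <;>
  rcases sign_eq_one_or (k := k) i l with h₂ | h₂ <;>
  rw [h₁, h₂] <;>
  simp only [mul_one, mul_neg, neg_neg, one_smul, neg_smul] <;>
  noncomm_ring

end LieWord

/-! ### Representing words in the two operations by series -/

namespace DiWord

open LieWord FreeDialgebra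

/-- The series that represents a word in the letters and the two operations. -/
noncomputable def series (k : Type*) [Field k] {n : ℕ} (p : Fin n → ZMod 2) :
    DiWord n → WordSeries k n
  | of x => (if x = 0 then 1 else 0) + PowerSeries.X * PowerSeries.C (FreeAlgebra.ι k x)
  -- Dividing the product by the unit series turns that series, which represents the letter `1`,
  -- into a unit modulo level 0.
  | mul u v => series k p u * series k p v * unitSeriesInv k n
  | br u v => seriesBracket (sign k (u.parity p) (v.parity p)) (series k p u) (series k p v)

variable {k : Type*} [Field k] {n : ℕ} {p : Fin n → ZMod 2}

theorem series_mem (w : DiWord n) : w.series k p ∈ seriesFiltration k p (w.parity p) 1 := by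
  induction w with
  | of x =>
    refine add_mem ?_ (X_mul_C_mem_seriesFiltration (FreeMagma.of x))
    split_ifs with h
    · subst h
      exact one_mem_seriesFiltration
    · exact zero_mem _
  | mul u v hu hv => exact mul_unitSeriesInv_mem (mul_mem_seriesFiltration_right hu hv)
  | br u v hu hv =>
    have := seriesBracket_mem hu hv
    exact this

end DiWord

/-! ### The defining relations hold modulo negligible series -/

namespace FreeDialgebra

open LieWord

variable {k : Type*} [Field k] {n : ℕ} {p : Fin n → ZMod 2}

theorem extend_word_word (f : DiWord n → DiWord n → DiWord n) (u v : DiWord n) :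
    extend f (word u) (word v) = (word (f u v) : FreeDialgebra k n) := by
  have h : extend f (word u) = (Finsupp.linearCombination k
      (fun v => (word (f u v) : FreeDialgebra k n)) : (DiWord n →₀ k) →ₗ[k] FreeDialgebra k n) :=
    (Finsupp.linearCombination_single k 1 u).trans (one_smul k _)
  rw [h]
  exact (Finsupp.linearCombination_single k 1 v).trans (one_smul k _)

theorem word_mul_word (u v : DiWord n) :
    (word u * word v : FreeDialgebra k n) = word (DiWord.mul u v) := by
  exact extend_word_word _ u v

theorem word_br_word (u v : DiWord n) :
    (⁅(word u : FreeDialgebra k n), (word v : FreeDialgebra k n)⁆ : FreeDialgebra k n) =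
      word (DiWord.br u v) := by
  exact extend_word_word _ u v

theorem add_mul' (a b c : FreeDialgebra k n) : (a + b) * c = a * c + b * c :=
  LinearMap.map_add₂ mulHom a b c

theorem mul_add' (a b c : FreeDialgebra k n) : a * (b + c) = a * b + a * c := map_add (mulHom a) b c

theorem smul_mul' (t : k) (a b : FreeDialgebra k n) : (t • a) * b = t • (a * b) :=
  LinearMap.map_smul₂ mulHom t a b

theorem mul_smul' (t : k) (a b : FreeDialgebra k n) : a * (t • b) = t • (a * b) :=
  map_smul (mulHom a) t b

theorem zero_mul' (a : FreeDialgebra k n) : 0 * a = 0 := LinearMap.map_zero₂ mulHom a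

theorem mul_zero' (a : FreeDialgebra k n) : a * 0 = 0 := map_zero (mulHom a)

theorem add_br' (a b c : FreeDialgebra k n) : (⁅a + b, c⁆ : FreeDialgebra k n) = ⁅a, c⁆ + ⁅b, c⁆ :=
  LinearMap.map_add₂ brHom a b c

theorem br_add' (a b c : FreeDialgebra k n) : (⁅a, b + c⁆ : FreeDialgebra k n) = ⁅a, b⁆ + ⁅a, c⁆ :=
  map_add (brHom a) b c

theorem smul_br' (t : k) (a b : FreeDialgebra k n) : (⁅t • a, b⁆ : FreeDialgebra k n) = t • ⁅a, b⁆ :=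
  LinearMap.map_smul₂ brHom t a b

theorem br_smul' (t : k) (a b : FreeDialgebra k n) : (⁅a, t • b⁆ : FreeDialgebra k n) = t • ⁅a, b⁆ :=
  map_smul (brHom a) t b

theorem zero_br' (a : FreeDialgebra k n) : (⁅(0 : FreeDialgebra k n), a⁆ : FreeDialgebra k n) = 0 :=
  LinearMap.map_zero₂ brHom a

theorem br_zero' (a : FreeDialgebra k n) : (⁅a, (0 : FreeDialgebra k n)⁆ : FreeDialgebra k n) = 0 :=
  map_zero (brHom a)

theorem mul_mem_homogeneous {i j : ZMod 2} {a b : FreeDialgebra k n} (ha : a ∈ homogeneous k p i)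
    (hb : b ∈ homogeneous k p j) : a * b ∈ homogeneous k p (i + j) := by
  refine Submodule.span_induction₂ (p := fun a b _ _ => a * b ∈ homogeneous k p (i + j))
    ?_ ?_ ?_ ?_ ?_ ?_ ?_ ha hb
  · rintro _ _ ⟨u, rfl, rfl⟩ ⟨v, rfl, rfl⟩
    rw [word_mul_word]
    exact word_mem_homogeneous p (DiWord.mul u v)
  · intro b _
    rw [zero_mul']
    exact zero_mem _
  · intro a _
    rw [mul_zero']
    exact zero_mem _
  · intro a a' b _ _ _ h h'
    rw [add_mul']
    exact add_mem h h'
  · intro a b b' _ _ _ h h'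
    rw [mul_add']
    exact add_mem h h'
  · intro c a b _ _ h
    rw [smul_mul']
    exact Submodule.smul_mem _ _ h
  · intro c a b _ _ h
    rw [mul_smul']
    exact Submodule.smul_mem _ _ h

theorem br_mem_homogeneous {i j : ZMod 2} {a b : FreeDialgebra k n} (ha : a ∈ homogeneous k p i)
    (hb : b ∈ homogeneous k p j) : ⁅a, b⁆ ∈ homogeneous k p (i + j) := by
  refine Submodule.span_induction₂ (p := fun a b _ _ => ⁅a, b⁆ ∈ homogeneous k p (i + j))
    ?_ ?_ ?_ ?_ ?_ ?_ ?_ ha hb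
  · rintro _ _ ⟨u, rfl, rfl⟩ ⟨v, rfl, rfl⟩
    rw [word_br_word]
    exact word_mem_homogeneous p (DiWord.br u v)
  · intro b _
    rw [zero_br']
    exact zero_mem _
  · intro a _
    rw [br_zero']
    exact zero_mem _
  · intro a a' b _ _ _ h h'
    rw [add_br']
    exact add_mem h h'
  · intro a b b' _ _ _ h h'
    rw [br_add']
    exact add_mem h h'
  · intro c a b _ _ h
    rw [smul_br']
    exact Submodule.smul_mem _ _ h
  · intro c a b _ _ h
    rw [br_smul']
    exact Submodule.smul_mem _ _ h

theorem one_mem_homogeneous : (1 : FreeDialgebra k n) ∈ homogeneous k p 0 :=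
  word_mem_homogeneous p (.of 0)

/-- The linear map from `D_X` to series that sends a word to the series representing it. -/
noncomputable def toSeries (k : Type*) [Field k] {n : ℕ} (p : Fin n → ZMod 2) :
    FreeDialgebra k n →ₗ[k] WordSeries k n :=
  Finsupp.linearCombination k (DiWord.series k p)

/-- The part of `toSeries` on words of parity `i`. -/
noncomputable def toSeriesPart (k : Type*) [Field k] {n : ℕ} (p : Fin n → ZMod 2) (i : ZMod 2) :
    FreeDialgebra k n →ₗ[k] WordSeries k n :=
  Finsupp.linearCombination k fun w => if w.parity p = i then w.series k p else 0

theorem toSeries_word (w : DiWord n) : toSeries k p (word w) = w.series k p :=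
  (Finsupp.linearCombination_single k 1 w).trans (one_smul k _)

theorem toSeriesPart_word (i : ZMod 2) (w : DiWord n) :
    toSeriesPart k p i (word w) = if w.parity p = i then w.series k p else 0 :=
  (Finsupp.linearCombination_single k 1 w).trans (one_smul k _)

theorem toSeriesPart_add (a : FreeDialgebra k n) :
    toSeriesPart k p 0 a + toSeriesPart k p 1 a = toSeries k p a := by
  induction a using induction_word with
  | h0 => simp
  | hw w =>
    rw [toSeriesPart_word, toSeriesPart_word, toSeries_word]
    rcases ZMod.two_eq_zero_or_one (w.parity p) with h | h <;> simp [h]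
  | hadd a b ha hb =>
    rw [map_add, map_add, map_add, ← ha, ← hb]
    abel
  | hsmul t a ha => rw [map_smul, map_smul, map_smul, ← ha, smul_add]

theorem toSeries_mem {i : ZMod 2} {a : FreeDialgebra k n} (ha : a ∈ homogeneous k p i) :
    toSeries k p a ∈ seriesFiltration k p i 1 := by
  have : homogeneous k p i ≤ (seriesFiltration k p i 1).comap (toSeries k p) := by
    rw [homogeneous, Submodule.span_le]
    rintro _ ⟨w, rfl, rfl⟩
    rw [SetLike.mem_coe, Submodule.mem_comap, toSeries_word]
    exact w.series_mem
  exact this ha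

theorem toSeriesPart_of_mem {i : ZMod 2} {a : FreeDialgebra k n} (ha : a ∈ homogeneous k p i)
    (j : ZMod 2) : toSeriesPart k p j a = if i = j then toSeries k p a else 0 := by
  have : homogeneous k p i ≤ LinearMap.eqLocus (toSeriesPart k p j)
      (if i = j then toSeries k p else 0) := by
    rw [homogeneous, Submodule.span_le]
    rintro _ ⟨w, rfl, rfl⟩
    rw [SetLike.mem_coe, LinearMap.mem_eqLocus, toSeriesPart_word]
    split_ifs with h
    · rw [toSeries_word]
    · rfl
  have h := this ha
  rw [LinearMap.mem_eqLocus] at h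
  rw [h]
  split_ifs <;> rfl

theorem toSeries_one : toSeries k p 1 = unitSeries k n := by
  change toSeries k p (word (.of 0)) = _
  rw [toSeries_word, DiWord.series, if_pos rfl, unitSeries]

theorem toSeries_mul (a b : FreeDialgebra k n) :
    toSeries k p (a * b) = toSeries k p a * toSeries k p b * unitSeriesInv k n := by
  induction a using induction_word with
  | h0 => rw [zero_mul', map_zero, zero_mul, zero_mul]
  | hadd a a' ha ha' => rw [add_mul', map_add, ha, ha', map_add, add_mul, add_mul]
  | hsmul t a ha => rw [smul_mul', map_smul, ha, map_smul, smul_mul_assoc, smul_mul_assoc]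
  | hw u =>
    induction b using induction_word with
    | h0 => rw [mul_zero', map_zero, mul_zero, zero_mul]
    | hadd b b' hb hb' => rw [mul_add', map_add, hb, hb', map_add, mul_add, add_mul]
    | hsmul t b hb => rw [mul_smul', map_smul, hb, map_smul, mul_smul_comm, smul_mul_assoc]
    | hw v => rw [word_mul_word, toSeries_word, toSeries_word, toSeries_word, DiWord.series]

theorem toSeries_br {i j : ZMod 2} {a b : FreeDialgebra k n} (ha : a ∈ homogeneous k p i)
    (hb : b ∈ homogeneous k p j) :
    toSeries k p ⁅a, b⁆ = seriesBracket (sign k i j) (toSeries k p a) (toSeries k p b) := by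
  refine Submodule.span_induction₂ (p := fun a b _ _ => toSeries k p ⁅a, b⁆ =
    seriesBracket (sign k i j) (toSeries k p a) (toSeries k p b)) ?_ ?_ ?_ ?_ ?_ ?_ ?_ ha hb
  · rintro _ _ ⟨u, rfl, rfl⟩ ⟨v, rfl, rfl⟩
    rw [word_br_word, toSeries_word, toSeries_word, toSeries_word, DiWord.series]
  · intro b _
    simp [zero_br', seriesBracket]
  · intro a _
    simp [br_zero', seriesBracket]
  · intro a a' b _ _ _ h h'
    rw [add_br', map_add, h, h', seriesBracket, seriesBracket, seriesBracket, map_add, ← map_add]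
    congr 1
    rw [add_mul, mul_add, smul_add]
    abel
  · intro a b b' _ _ _ h h'
    rw [br_add', map_add, h, h', seriesBracket, seriesBracket, seriesBracket, map_add, ← map_add]
    congr 1
    rw [add_mul, mul_add, smul_add]
    abel
  · intro c a b _ _ h
    rw [smul_br', map_smul, h, seriesBracket, seriesBracket, map_smul, ← map_smul]
    congr 1
    rw [smul_mul_assoc, mul_smul_comm, smul_sub, smul_comm]
  · intro c a b _ _ h
    rw [br_smul', map_smul, h, seriesBracket, seriesBracket, map_smul, ← map_smul]
    congr 1
    rw [smul_mul_assoc, mul_smul_comm, smul_sub, smul_comm]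

/-- The elements of `D_X` whose homogeneous parts are represented by negligible series. -/
noncomputable def seriesKernel (k : Type*) [Field k] {n : ℕ} (p : Fin n → ZMod 2) :
    Submodule k (FreeDialgebra k n) :=
  -- The parities are tested separately because the sign in the bracket of series is fixed by
  -- homogeneous arguments.
  ⨅ i, (seriesFiltration k p i 0).comap (toSeriesPart k p i)

theorem mem_seriesKernel {a : FreeDialgebra k n} :
    a ∈ seriesKernel k p ↔ ∀ i, toSeriesPart k p i a ∈ seriesFiltration k p i 0 := by
  simp [seriesKernel]

theorem mem_seriesKernel_of_homogeneous {i : ZMod 2} {a : FreeDialgebra k n}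
    (ha : a ∈ homogeneous k p i) (h : toSeries k p a ∈ seriesFiltration k p i 0) :
    a ∈ seriesKernel k p := by
  rw [mem_seriesKernel]
  intro j
  rw [toSeriesPart_of_mem ha]
  split_ifs with e
  · rwa [← e]
  · exact zero_mem _

/-- Every element is the sum of its even and odd parts. -/
theorem exists_homogeneous_add (p : Fin n → ZMod 2) (a : FreeDialgebra k n) :
    ∃ a₀ ∈ homogeneous k p 0, ∃ a₁ ∈ homogeneous k p 1, a = a₀ + a₁ := by
  induction a using induction_word with
  | h0 => exact ⟨0, zero_mem _, 0, zero_mem _, (add_zero _).symm⟩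
  | hw w =>
    have hw := word_mem_homogeneous (k := k) p w
    rcases ZMod.two_eq_zero_or_one (w.parity p) with h | h <;> rw [h] at hw
    · exact ⟨_, hw, 0, zero_mem _, (add_zero _).symm⟩
    · exact ⟨0, zero_mem _, _, hw, (zero_add _).symm⟩
  | hadd a b ha hb =>
    obtain ⟨a₀, ha₀, a₁, ha₁, rfl⟩ := ha
    obtain ⟨b₀, hb₀, b₁, hb₁, rfl⟩ := hb
    exact ⟨_, add_mem ha₀ hb₀, _, add_mem ha₁ hb₁, add_add_add_comm _ _ _ _⟩
  | hsmul t a ha =>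
    obtain ⟨a₀, ha₀, a₁, ha₁, rfl⟩ := ha
    exact ⟨_, Submodule.smul_mem _ t ha₀, _, Submodule.smul_mem _ t ha₁, smul_add _ _ _⟩

theorem exists_homogeneous_kernel_add {s : FreeDialgebra k n} (hs : s ∈ seriesKernel k p) :
    ∃ s₀ ∈ homogeneous k p 0, ∃ s₁ ∈ homogeneous k p 1, s = s₀ + s₁ ∧
      toSeries k p s₀ ∈ seriesFiltration k p 0 0 ∧ toSeries k p s₁ ∈ seriesFiltration k p 1 0 := by
  obtain ⟨s₀, hs₀, s₁, hs₁, rfl⟩ := exists_homogeneous_add p s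
  rw [mem_seriesKernel] at hs
  have h0 := hs 0
  have h1 := hs 1
  rw [map_add, toSeriesPart_of_mem hs₀, toSeriesPart_of_mem hs₁] at h0 h1
  simp only [if_true, zero_ne_one, one_ne_zero, if_false, zero_add, add_zero] at h0 h1
  exact ⟨s₀, hs₀, s₁, hs₁, rfl, h0, h1⟩

/-- Level 0 absorbs products and brackets with level 1; the general case follows by splitting both
arguments into even and odd parts. -/
theorem seriesKernel_closed {s : FreeDialgebra k n} (hs : s ∈ seriesKernel k p)
    (d : FreeDialgebra k n) : d * s ∈ seriesKernel k p ∧ s * d ∈ seriesKernel k p ∧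
      ⁅d, s⁆ ∈ seriesKernel k p ∧ ⁅s, d⁆ ∈ seriesKernel k p := by
  have hom : ∀ i j (a b : FreeDialgebra k n), a ∈ homogeneous k p i → b ∈ homogeneous k p j →
      toSeries k p b ∈ seriesFiltration k p j 0 → a * b ∈ seriesKernel k p ∧
        b * a ∈ seriesKernel k p ∧ ⁅a, b⁆ ∈ seriesKernel k p ∧ ⁅b, a⁆ ∈ seriesKernel k p := by
    intro i j a b ha hb hb'
    have ha' := toSeries_mem ha
    refine ⟨mem_seriesKernel_of_homogeneous (mul_mem_homogeneous ha hb) ?_,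
      mem_seriesKernel_of_homogeneous (mul_mem_homogeneous hb ha) ?_,
      mem_seriesKernel_of_homogeneous (br_mem_homogeneous ha hb) ?_,
      mem_seriesKernel_of_homogeneous (br_mem_homogeneous hb ha) ?_⟩
    · rw [toSeries_mul]
      exact mul_unitSeriesInv_mem (mul_mem_seriesFiltration_left ha' hb')
    · rw [toSeries_mul]
      exact mul_unitSeriesInv_mem (mul_mem_seriesFiltration_right hb' ha')
    · rw [toSeries_br ha hb]
      have := seriesBracket_mem ha' hb'
      exact this
    · rw [toSeries_br hb ha]
      have := seriesBracket_mem hb' ha'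
      exact this
  obtain ⟨s₀, hs₀, s₁, hs₁, rfl, h0, h1⟩ := exists_homogeneous_kernel_add hs
  obtain ⟨d₀, hd₀, d₁, hd₁, rfl⟩ := exists_homogeneous_add p d
  obtain ⟨a1, a2, a3, a4⟩ := hom _ _ _ _ hd₀ hs₀ h0
  obtain ⟨b1, b2, b3, b4⟩ := hom _ _ _ _ hd₀ hs₁ h1
  obtain ⟨c1, c2, c3, c4⟩ := hom _ _ _ _ hd₁ hs₀ h0
  obtain ⟨e1, e2, e3, e4⟩ := hom _ _ _ _ hd₁ hs₁ h1
  simp only [add_mul', mul_add', add_br', br_add']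
  exact ⟨add_mem (add_mem a1 c1) (add_mem b1 e1), add_mem (add_mem a2 b2) (add_mem c2 e2),
    add_mem (add_mem a3 c3) (add_mem b3 e3), add_mem (add_mem a4 b4) (add_mem c4 e4)⟩

/-- Anticommutativity and Jacobi become exact identities of series. The other relations hold up to
supercommutators, which lie in level 0. -/
theorem relation_mem_seriesKernel {r : FreeDialgebra k n} (h : Relation p r) :
    r ∈ seriesKernel k p := by
  cases h with
  | anticomm i j a b ha hb =>
    have hba := br_mem_homogeneous hb ha
    rw [add_comm j i] at hba
    refine mem_seriesKernel_of_homogeneous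
      (add_mem (br_mem_homogeneous ha hb) (Submodule.smul_mem _ _ hba)) ?_
    rw [map_add, map_smul, toSeries_br ha hb, toSeries_br hb ha, seriesBracket_anticomm]
    exact zero_mem _
  | comm i j a b ha hb =>
    have hba := mul_mem_homogeneous hb ha
    rw [add_comm j i] at hba
    refine mem_seriesKernel_of_homogeneous
      (sub_mem (mul_mem_homogeneous ha hb) (Submodule.smul_mem _ _ hba)) ?_
    rw [map_sub, map_smul, toSeries_mul, toSeries_mul, ← smul_mul_assoc, ← sub_mul]
    exact mul_unitSeriesInv_mem (comm_mem_seriesFiltration (toSeries_mem ha) (toSeries_mem hb))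
  | one_mul i a ha =>
    have h1 := mul_mem_homogeneous (one_mem_homogeneous (k := k) (p := p)) ha
    rw [zero_add] at h1
    refine mem_seriesKernel_of_homogeneous (sub_mem h1 ha) ?_
    -- With τ the unit series and ρ its inverse, τaρ - a = [τ,a]ρ.
    have h := comm_mem_seriesFiltration (unitSeries_mem (k := k) (p := p)) (toSeries_mem ha)
    rw [sign_zero_left, one_smul, zero_add] at h
    have h' := mul_unitSeriesInv_mem h
    rw [map_sub, toSeries_mul, toSeries_one]
    rwa [sub_mul, mul_assoc (toSeries k p a), unitSeries_mul_inv, mul_one] at h'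
  | assoc i j l a b c ha hb hc =>
    have hl := mul_mem_homogeneous (mul_mem_homogeneous ha hb) hc
    have hr := mul_mem_homogeneous ha (mul_mem_homogeneous hb hc)
    rw [← add_assoc] at hr
    refine mem_seriesKernel_of_homogeneous (sub_mem hl hr) ?_
    -- With ρ the inverse of the unit series, the two bracketings differ by ab[ρ,c]ρ.
    have h := comm_mem_seriesFiltration (unitSeriesInv_mem (k := k) (p := p)) (toSeries_mem hc)
    rw [sign_zero_left, one_smul, zero_add] at h
    have h' := mul_unitSeriesInv_mem (mul_mem_seriesFiltration_left
      (mul_mem_seriesFiltration_left (toSeries_mem ha) (toSeries_mem hb)) h)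
    rw [map_sub, toSeries_mul, toSeries_mul, toSeries_mul, toSeries_mul]
    convert h' using 1
    noncomm_ring
  | leibniz i j l a b c ha hb hc =>
    have hab := br_mem_homogeneous ha hb
    have hac := br_mem_homogeneous ha hc
    have hbc := mul_mem_homogeneous hb hc
    have hD := br_mem_homogeneous ha (one_mem_homogeneous (k := k) (p := p))
    have m1 := mul_mem_homogeneous hab hc
    have m2 := mul_mem_homogeneous hb hac
    have m3 := mul_mem_homogeneous (mul_mem_homogeneous hD hb) hc
    have m4 := br_mem_homogeneous ha hbc
    rw [add_left_comm, ← add_assoc] at m2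
    rw [add_zero] at m3
    rw [← add_assoc] at m4
    refine mem_seriesKernel_of_homogeneous
      (sub_mem (sub_mem (add_mem m1 (Submodule.smul_mem _ _ m2)) m3) m4) ?_
    rw [map_sub, map_sub, map_add, map_smul, toSeries_mul, toSeries_mul, toSeries_mul, toSeries_mul,
      toSeries_br ha hb, toSeries_br ha hc, toSeries_br ha one_mem_homogeneous, toSeries_br ha hbc,
      toSeries_mul, toSeries_one]
    exact seriesBracket_leibniz (toSeries_mem ha) (toSeries_mem hb) (toSeries_mem hc)
  | jacobi i j l a b c ha hb hc =>
    have hab := br_mem_homogeneous ha hb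
    have hac := br_mem_homogeneous ha hc
    have hbc := br_mem_homogeneous hb hc
    have m1 := br_mem_homogeneous hab hc
    have m2 := br_mem_homogeneous hb hac
    have m3 := br_mem_homogeneous ha hbc
    rw [add_left_comm, ← add_assoc] at m2
    rw [← add_assoc] at m3
    refine mem_seriesKernel_of_homogeneous
      (sub_mem (add_mem m1 (Submodule.smul_mem _ _ m2)) m3) ?_
    rw [map_sub, map_add, map_smul, toSeries_br hab hc, toSeries_br hb hac, toSeries_br ha hbc,
      toSeries_br ha hb, toSeries_br ha hc, toSeries_br hb hc,
      seriesBracket_jacobi (toSeries_mem ha) (toSeries_mem hb) (toSeries_mem hc)]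
    exact zero_mem _

theorem ideal_le_seriesKernel : ideal k p ≤ seriesKernel k p :=
  sInf_le ⟨fun _ h => relation_mem_seriesKernel h, fun _ hs d => seriesKernel_closed hs d⟩

end FreeDialgebra

/-! ### Linear independence in `GenP` -/

namespace LieWord

open FreeDialgebra

variable {k : Type*} [Field k] {n : ℕ} {p : Fin n → ZMod 2} {lt : LieWord n → LieWord n → Prop}

/-- A bracket word as a word in two operations. -/
def toDiWord : LieWord n → DiWord n
  | .of x => .of x
  | u * v => .br (toDiWord u) (toDiWord v)

/-- The product of a list of bracket words as a word in two operations. -/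
def listToDiWord : List (LieWord n) → DiWord n
  | [] => .of 0
  | w :: l => .mul (toDiWord w) (listToDiWord l)

theorem parity_toDiWord (w : LieWord n) : (toDiWord w).parity p = parity p w := by
  induction w with
  | of x => rfl
  | mul u v hu hv =>
    change (toDiWord u).parity p + (toDiWord v).parity p = parity p u + parity p v
    rw [hu, hv]

theorem C_smul (c : k) (a : FreeAlgebra k (Fin (n + 1))) :
    (PowerSeries.C (c • a) : WordSeries k n) = c • PowerSeries.C a := by
  ext m
  rw [PowerSeries.coeff_smul, PowerSeries.coeff_C, PowerSeries.coeff_C]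
  split_ifs
  · rfl
  · rw [smul_zero]

/-- The constant 1 carried by the letter `1` is central, so it vanishes in every bracket and the
letter acts there as a free Lie generator. -/
theorem series_toDiWord (w : LieWord n) : (toDiWord w).series k p =
    (if w = FreeMagma.of 0 then 1 else 0) + PowerSeries.X * PowerSeries.C (commEval k p w) := by
  induction w with
  | of x =>
    have : (FreeMagma.of x = (FreeMagma.of 0 : LieWord n)) ↔ x = 0 :=
      ⟨fun h => by injection h, fun h => by rw [h]⟩
    simp only [this]
    rfl
  | mul u v hu hv =>
    change (toDiWord (u * v)).series k p =
      (if u * v = FreeMagma.of 0 then 1 else 0) + PowerSeries.X * PowerSeries.C (commEval k p (u * v))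
    have hne : u * v ≠ FreeMagma.of 0 := fun h => by cases h
    rw [if_neg hne, zero_add]
    apply X_mul_cancel
    have h := X_mul_seriesBracket ((toDiWord u).series_mem (k := k) (p := p))
      ((toDiWord v).series_mem (k := k) (p := p))
    change PowerSeries.X * (DiWord.br (toDiWord u) (toDiWord v)).series k p = _
    rw [DiWord.series, h, hu, hv, parity_toDiWord, parity_toDiWord, commEval_mul, map_sub, C_smul,
      map_mul, map_mul]
    have h0 : parity p (FreeMagma.of 0) = 0 := rfl
    have key : PowerSeries.X * PowerSeries.C (commEval k p u) *
        (PowerSeries.X * PowerSeries.C (commEval k p v)) -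
          sign k (parity p u) (parity p v) • (PowerSeries.X * PowerSeries.C (commEval k p v) *
            (PowerSeries.X * PowerSeries.C (commEval k p u))) =
        PowerSeries.X * (PowerSeries.X * (PowerSeries.C (commEval k p u) *
          PowerSeries.C (commEval k p v) - sign k (parity p u) (parity p v) •
            (PowerSeries.C (commEval k p v) * PowerSeries.C (commEval k p u)))) := by
      rw [mul_X_mul, mul_X_mul, mul_assoc, mul_assoc, mul_sub, mul_sub, mul_smul_comm,
        mul_smul_comm]
    rw [← key]
    by_cases hu0 : u = FreeMagma.of 0
    · rw [hu0, if_pos rfl, h0, sign_zero_left, one_smul, one_smul]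
      split_ifs <;> noncomm_ring
    · rw [if_neg hu0, zero_add]
      by_cases hv0 : v = FreeMagma.of 0
      · rw [hv0, if_pos rfl, h0, sign_zero_right, one_smul, one_smul]
        noncomm_ring
      · rw [if_neg hv0, zero_add]

theorem coeff_mul_lowest {a b : WordSeries k n} {r : ℕ}
    (ha : ∀ m < r, PowerSeries.coeff m a = 0) (hb : PowerSeries.coeff 0 b = 1) :
    (∀ m < r, PowerSeries.coeff m (a * b) = 0) ∧
      PowerSeries.coeff r (a * b) = PowerSeries.coeff r a := by
  constructor
  · intro m hm
    rw [PowerSeries.coeff_mul]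
    refine Finset.sum_eq_zero fun x hx => ?_
    have hx := Finset.HasAntidiagonal.mem_antidiagonal.1 hx
    rw [ha _ (by omega), zero_mul]
  · rw [PowerSeries.coeff_mul, Finset.sum_eq_single (r, 0), hb, mul_one]
    · rintro ⟨x, y⟩ hx hne
      have hx := Finset.HasAntidiagonal.mem_antidiagonal.1 hx
      have : x < r := by
        by_contra hlt
        apply hne
        rw [Prod.mk.injEq]
        simp only at hx
        omega
      rw [ha _ this, zero_mul]
    · intro h
      exact absurd (Finset.HasAntidiagonal.mem_antidiagonal.2 (add_zero r)) h

/-- Each factor other than the letter `1` contributes exactly one X, while the unit series and its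
inverse have constant coefficient 1 and leave the lowest term alone. -/
theorem coeff_series_listToDiWord {l : List (LieWord n)} (hl : FreeMagma.of 0 ∉ l) :
    (∀ m < l.length, PowerSeries.coeff m ((listToDiWord l).series k p) = 0) ∧
      PowerSeries.coeff l.length ((listToDiWord l).series k p) = prodEval k p l := by
  induction l with
  | nil =>
    refine ⟨fun m hm => (Nat.not_lt_zero _ hm).elim, ?_⟩
    simp [listToDiWord, DiWord.series, prodEval]
  | cons w l ih =>
    obtain ⟨hw, hl'⟩ := not_or.1 (fun h => hl (List.mem_cons.2 h))
    obtain ⟨ih₁, ih₂⟩ := ih hl'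
    have hρ : PowerSeries.coeff 0 (unitSeriesInv k n) = 1 := by simp [unitSeriesInv]
    obtain ⟨h₁, h₂⟩ := coeff_mul_lowest ih₁ hρ
    rw [listToDiWord, DiWord.series, series_toDiWord, if_neg fun h => hw h.symm, zero_add,
      mul_assoc, mul_assoc]
    constructor
    · intro m hm
      cases m with
      | zero => rw [PowerSeries.coeff_zero_X_mul]
      | succ m =>
        rw [PowerSeries.coeff_succ_X_mul, PowerSeries.coeff_C_mul,
          h₁ m (Nat.lt_of_succ_lt_succ hm), mul_zero]
    · rw [List.length_cons, PowerSeries.coeff_succ_X_mul, PowerSeries.coeff_C_mul, h₂, ih₂,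
        prodEval_cons]

theorem linearIndependent_listToDiWord [CharZero k] (hlt : IsAdmissibleOrder lt) :
    LinearIndependent k fun s : {s : List (LieWord n) // IsStandard p lt s ∧ FreeMagma.of 0 ∉ s} =>
      GenP.mk k p (word (listToDiWord s.1)) := by
  classical
  have hli := linearIndependent_prodEval (k := k) (p := p) hlt
  rw [linearIndependent_iff']
  intro J g hg
  have hker : ∑ s ∈ J, g s • (word (listToDiWord s.1) : FreeDialgebra k n) ∈ seriesKernel k p := by
    refine ideal_le_seriesKernel ?_
    rw [← sub_zero (∑ s ∈ J, _), ← GenP.mk_eq_mk, map_sum, map_zero, ← hg]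
    exact Finset.sum_congr rfl fun s _ => map_smul _ _ _
  -- Negligibility bounds the X^r coefficient by products of fewer than r bracket words, and
  -- straightening never increases the number of factors.
  have hmem : ∀ r, ∑ s ∈ J, g s • PowerSeries.coeff r ((listToDiWord s.1).series k p) ∈
      Submodule.span k ((fun s : {s : List (LieWord n) // IsStandard p lt s} =>
        prodEval k p s.1) '' {s | s.1.length < r}) := by
    intro r
    have hle : ∀ i, lengthFiltration k p i r ≤
        Submodule.span k ((fun s : {s : List (LieWord n) // IsStandard p lt s} =>
          prodEval k p s.1) '' {s | s.1.length < r}) := by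
      intro i
      rw [lengthFiltration, Submodule.span_le]
      rintro _ ⟨l, ⟨hl, -⟩, rfl⟩
      refine (Submodule.span_mono ?_ : standardSpan k p lt _ _ ≤ _)
        (prodEval_mem_standardSpan_of_list (k := k) (p := p) hlt l)
      rintro _ ⟨s, ⟨hs, hsl, -⟩, rfl⟩
      exact ⟨⟨s, hs⟩, hsl.trans_lt hl, rfl⟩
    rw [mem_seriesKernel] at hker
    have h := add_mem (hle 0 (hker 0 r)) (hle 1 (hker 1 r))
    rw [← map_add, toSeriesPart_add, map_sum, map_sum] at h
    convert h using 1
    refine Finset.sum_congr rfl fun s _ => ?_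
    rw [map_smul, PowerSeries.coeff_smul, toSeries_word]
  -- In the X^r coefficient the shorter lists drop out by induction and the longer ones have no
  -- term. The lists of length r give a combination of products of r factors that lies in the span
  -- of products with fewer factors; independence forces it to be trivial.
  have main : ∀ r, ∀ s ∈ J, s.1.length = r → g s = 0 := by
    intro r
    induction r using Nat.strong_induction_on with
    | _ r ih =>
    have hsum : ∑ s ∈ J, g s • PowerSeries.coeff r ((listToDiWord s.1).series k p) =
        ∑ s ∈ J with s.1.length = r, g s • prodEval k p s.1 := by
      rw [Finset.sum_filter]
      refine Finset.sum_congr rfl fun s hs => ?_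
      obtain ⟨h₁, h₂⟩ := coeff_series_listToDiWord (k := k) (p := p) s.2.2
      split_ifs with h
      · rw [← h, h₂]
      · rcases lt_or_gt_of_ne h with h | h
        · rw [ih _ h s hs rfl, zero_smul]
        · rw [h₁ r h, smul_zero]
    have hmem' : ∑ s ∈ J with s.1.length = r, g s • prodEval k p s.1 ∈
        Submodule.span k ((fun s : {s : List (LieWord n) // IsStandard p lt s} =>
          prodEval k p s.1) '' {s | s.1.length = r}) := by
      refine sum_mem fun s hs => Submodule.smul_mem _ _ (Submodule.subset_span ?_)
      exact ⟨⟨s.1, s.2.1⟩, (Finset.mem_filter.1 hs).2, rfl⟩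
    have hdis : Disjoint {s : {s : List (LieWord n) // IsStandard p lt s} | s.1.length = r}
        {s | s.1.length < r} := by
      rw [Set.disjoint_left]
      intro s hs hs'
      exact absurd hs' (by
        have : s.1.length = r := hs
        simp [this])
    have hzero := (Submodule.disjoint_def.1 (hli.disjoint_span_image hdis)) _ hmem'
      (hsum ▸ hmem r)
    have hli' := hli.comp
      (fun s : {s : List (LieWord n) // IsStandard p lt s ∧ FreeMagma.of 0 ∉ s} => ⟨s.1, s.2.1⟩)
      fun s t h => Subtype.ext (Subtype.mk.inj h)
    intro s hs hsr
    exact (linearIndependent_iff'.1 hli') _ g hzero s (Finset.mem_filter.2 ⟨hs, hsr⟩)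
  exact fun s hs => main _ s hs rfl

end LieWord

/-! ### Spanning of `GenP` by standard products -/

namespace GenP

open LieWord FreeDialgebra

variable {k : Type*} [Field k] {n : ℕ} {p : Fin n → ZMod 2} {lt : LieWord n → LieWord n → Prop}

/-- The product in `GenP` of the values of a list of bracket words. -/
noncomputable def listEval (k : Type*) [Field k] {n : ℕ} (p : Fin n → ZMod 2)
    (l : List (LieWord n)) : GenP k p := (l.map (ofLieWord k p)).prod

theorem listEval_append (l₁ l₂ : List (LieWord n)) :
    listEval k p (l₁ ++ l₂) = listEval k p l₁ * listEval k p l₂ := by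
  simp [listEval]

theorem listEval_cons (w : LieWord n) (l : List (LieWord n)) :
    listEval k p (w :: l) = ofLieWord k p w * listEval k p l := by
  simp [listEval]

theorem listEval_nil : listEval k p [] = 1 := rfl

theorem mk_word_toDiWord (w : LieWord n) : mk k p (word (toDiWord w)) = ofLieWord k p w := by
  induction w with
  | of x => rfl
  | mul u v hu hv =>
    change mk k p (word (.br (toDiWord u) (toDiWord v))) = ⁅ofLieWord k p u, ofLieWord k p v⁆
    rw [← word_br_word, mk_br, hu, hv]

theorem mk_word_listToDiWord (l : List (LieWord n)) :
    mk k p (word (listToDiWord l)) = listEval k p l := by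
  induction l with
  | nil => rfl
  | cons w l ih => rw [listToDiWord, ← word_mul_word, mk_mul, ih, mk_word_toDiWord, listEval_cons]

instance : IsScalarTower k (GenP k p) (GenP k p) := ⟨smul_mul'⟩

instance : SMulCommClass k (GenP k p) (GenP k p) := ⟨fun t a b => (mul_smul' t a b).symm⟩

/-- The homogeneous component of `GenP` of parity `i`. -/
noncomputable def homogeneous (k : Type*) [Field k] {n : ℕ} (p : Fin n → ZMod 2) (i : ZMod 2) :
    Submodule k (GenP k p) := (FreeDialgebra.homogeneous k p i).map (mk k p)

theorem ofLieWord_mem (w : LieWord n) : ofLieWord k p w ∈ homogeneous k p (parity p w) := by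
  rw [← mk_word_toDiWord, ← parity_toDiWord]
  exact ⟨_, word_mem_homogeneous p _, rfl⟩

theorem listEval_mem (l : List (LieWord n)) : listEval k p l ∈ homogeneous k p (listParity p l) := by
  induction l with
  | nil => exact ⟨_, one_mem_homogeneous, rfl⟩
  | cons w l ih =>
    obtain ⟨a, ha, ha'⟩ := ofLieWord_mem (k := k) (p := p) w
    obtain ⟨b, hb, hb'⟩ := ih
    rw [listEval_cons, listParity_cons, ← ha', ← hb', ← mk_mul]
    exact ⟨_, mul_mem_homogeneous ha hb, rfl⟩

theorem br_anticomm {i j : ZMod 2} {a b : GenP k p} (ha : a ∈ homogeneous k p i)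
    (hb : b ∈ homogeneous k p j) : ⁅a, b⁆ = -(sign k i j • ⁅b, a⁆) := by
  obtain ⟨a, ha, rfl⟩ := ha
  obtain ⟨b, hb, rfl⟩ := hb
  have h := mem_ideal_of_relation (Relation.anticomm i j a b ha hb)
  rw [← mk_br, ← mk_br, ← map_smul, ← map_neg, mk_eq_mk, sub_neg_eq_add]
  exact h

theorem mul_supercomm {i j : ZMod 2} {a b : GenP k p} (ha : a ∈ homogeneous k p i)
    (hb : b ∈ homogeneous k p j) : a * b = sign k i j • (b * a) := by
  obtain ⟨a, ha, rfl⟩ := ha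
  obtain ⟨b, hb, rfl⟩ := hb
  have h := mem_ideal_of_relation (Relation.comm i j a b ha hb)
  rw [← mk_mul, ← mk_mul, ← map_smul, mk_eq_mk]
  exact h

theorem br_mul {i j l : ZMod 2} {a b c : GenP k p} (ha : a ∈ homogeneous k p i)
    (hb : b ∈ homogeneous k p j) (hc : c ∈ homogeneous k p l) :
    ⁅a, b * c⁆ = ⁅a, b⁆ * c + sign k i j • (b * ⁅a, c⁆) - ⁅a, 1⁆ * b * c := by
  obtain ⟨a, ha, rfl⟩ := ha
  obtain ⟨b, hb, rfl⟩ := hb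
  obtain ⟨c, hc, rfl⟩ := hc
  have h := mem_ideal_of_relation (Relation.leibniz i j l a b c ha hb hc)
  rw [← mk_one]
  simp only [← mk_mul, ← mk_br, ← map_smul, ← map_add, ← map_sub]
  symm
  rw [mk_eq_mk]
  exact h

theorem br_jacobi {i j l : ZMod 2} {a b c : GenP k p} (ha : a ∈ homogeneous k p i)
    (hb : b ∈ homogeneous k p j) (hc : c ∈ homogeneous k p l) :
    ⁅⁅a, b⁆, c⁆ = ⁅a, ⁅b, c⁆⁆ - sign k i j • ⁅b, ⁅a, c⁆⁆ := by
  obtain ⟨a, ha, rfl⟩ := ha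
  obtain ⟨b, hb, rfl⟩ := hb
  obtain ⟨c, hc, rfl⟩ := hc
  have h := mem_ideal_of_relation (Relation.jacobi i j l a b c ha hb hc)
  rw [eq_sub_iff_add_eq]
  simp only [← mk_br, ← map_smul, ← map_add]
  rw [mk_eq_mk]
  exact h

theorem isSuperLieEval_ofLieWord : IsSuperLieEval p (brHom k p) (ofLieWord k p) where
  mul _ _ := rfl
  anticomm u v := br_anticomm (ofLieWord_mem u) (ofLieWord_mem v)
  jacobi u v w := br_jacobi (ofLieWord_mem u) (ofLieWord_mem v) (ofLieWord_mem w)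

/-- The span of the products of bracket words. -/
noncomputable def listSpan (k : Type*) [Field k] {n : ℕ} (p : Fin n → ZMod 2) :
    Submodule k (GenP k p) := Submodule.span k (Set.range (listEval k p))

theorem listEval_mem_listSpan (l : List (LieWord n)) : listEval k p l ∈ listSpan k p :=
  Submodule.subset_span ⟨l, rfl⟩

theorem ofLieWord_mem_listSpan (w : LieWord n) : ofLieWord k p w ∈ listSpan k p := by
  have := listEval_mem_listSpan (k := k) (p := p) [w]
  rwa [listEval_cons, listEval_nil, mul_one] at this

theorem mul_mem_listSpan {a b : GenP k p} (ha : a ∈ listSpan k p) (hb : b ∈ listSpan k p) :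
    a * b ∈ listSpan k p := by
  refine LinearMap.BilinMap.apply_apply_mem_of_mem_span (listSpan k p) _ _ (mulHom k p) ?_ a b ha hb
  rintro _ ⟨l, rfl⟩ _ ⟨l', rfl⟩
  change listEval k p l * listEval k p l' ∈ _
  rw [← listEval_append]
  exact listEval_mem_listSpan _

/-- Leibniz peels off one factor at a time. Both the empty product and the D-term reduce to the
hypothesis at the letter `1`, whose value is the unit. -/
theorem br_listEval_mem_of_forall {i : ZMod 2} {g : GenP k p} (hg : g ∈ homogeneous k p i)
    (h : ∀ u, ⁅g, ofLieWord k p u⁆ ∈ listSpan k p) (l : List (LieWord n)) :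
    ⁅g, listEval k p l⁆ ∈ listSpan k p := by
  induction l with
  | nil => exact h (FreeMagma.of 0)
  | cons u l ih =>
    rw [listEval_cons, br_mul hg (ofLieWord_mem u) (listEval_mem l)]
    exact sub_mem (add_mem (mul_mem_listSpan (h u) (listEval_mem_listSpan l))
      (Submodule.smul_mem _ _ (mul_mem_listSpan (ofLieWord_mem_listSpan u) ih)))
      (mul_mem_listSpan (mul_mem_listSpan (h (FreeMagma.of 0)) (ofLieWord_mem_listSpan u))
        (listEval_mem_listSpan l))

/-- Leibniz is used once in each argument, with anticommutativity in between, until only brackets of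
two bracket words remain. -/
theorem br_mem_listSpan {a b : GenP k p} (ha : a ∈ listSpan k p) (hb : b ∈ listSpan k p) :
    ⁅a, b⁆ ∈ listSpan k p := by
  refine LinearMap.BilinMap.apply_apply_mem_of_mem_span (listSpan k p) _ _ (brHom k p) ?_ a b ha hb
  rintro _ ⟨l, rfl⟩ _ ⟨l', rfl⟩
  refine br_listEval_mem_of_forall (listEval_mem l) (fun u => ?_) l'
  rw [br_anticomm (listEval_mem l) (ofLieWord_mem u)]
  exact neg_mem (Submodule.smul_mem _ _ (br_listEval_mem_of_forall (ofLieWord_mem u)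
    (fun v => ofLieWord_mem_listSpan (u * v)) l))

theorem listSpan_eq_top : listSpan k p = ⊤ := by
  rw [eq_top_iff]
  rintro a -
  obtain ⟨a, rfl⟩ := mk_surjective a
  induction a using induction_word with
  | h0 =>
    rw [map_zero]
    exact zero_mem _
  | hadd a b ha hb =>
    rw [map_add]
    exact add_mem ha hb
  | hsmul t a ha =>
    rw [map_smul]
    exact Submodule.smul_mem _ _ ha
  | hw w =>
    induction w with
    | of x => exact ofLieWord_mem_listSpan (FreeMagma.of x)
    | mul u v hu hv =>
      rw [← word_mul_word, mk_mul]
      exact mul_mem_listSpan hu hv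
    | br u v hu hv =>
      rw [← word_br_word, mk_br]
      exact br_mem_listSpan hu hv

/-- The span of the products of standard lists that do not contain the letter `1`. -/
noncomputable def standardListSpan (k : Type*) [Field k] {n : ℕ} (p : Fin n → ZMod 2)
    (lt : LieWord n → LieWord n → Prop) : Submodule k (GenP k p) :=
  Submodule.span k (listEval k p '' {s | IsStandard p lt s ∧ FreeMagma.of 0 ∉ s})

variable [CharZero k]

theorem ofLieWord_mul_self {v : LieWord n} (hv : parity p v = 1) :
    ofLieWord k p v * ofLieWord k p v = 0 := by
  have h := mul_supercomm (ofLieWord_mem (k := k) (p := p) v) (ofLieWord_mem v)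
  rw [hv, sign_one_one, neg_one_smul] at h
  have h2 : (2 : k) • (ofLieWord k p v * ofLieWord k p v) = 0 := by
    rw [two_smul]
    nth_rw 1 [h]
    exact neg_add_cancel _
  exact (smul_eq_zero.1 h2).resolve_left two_ne_zero

open Classical in
theorem listEval_mem_standardListSpan {l : List (LieWord n)} (hl : ∀ w ∈ l, w ∈ shternSet p lt) :
    listEval k p l ∈ standardListSpan k p lt := by
  have hfilter : listEval k p l = listEval k p (l.filter (· ≠ FreeMagma.of 0)) := by
    clear hl
    induction l with
    | nil => rfl
    | cons w l ih =>
      by_cases hw : w = FreeMagma.of 0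
      · rw [List.filter_cons_of_neg (by simpa using hw), ← ih, listEval_cons, hw]
        exact one_mul _
      · rw [List.filter_cons_of_pos (by simpa using hw), listEval_cons, listEval_cons, ih]
  rw [hfilter]
  -- The zero subspace suffices: in `GenP` transpositions cost only a sign and odd squares vanish.
  have h := mem_sup_span_isStandard (p := p) (lt := lt) (f := listEval k p) (W := (⊥ : Submodule k (GenP k p)))
    (l := l.filter (· ≠ FreeMagma.of 0)) (fun w hw => hl w (List.mem_of_mem_filter hw)) ?_ ?_
  · rw [bot_sup_eq] at h
    refine (Submodule.span_mono (Set.image_mono ?_)) h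
    rintro s ⟨hs, hperm⟩
    refine ⟨hs, fun h0 => ?_⟩
    simpa using hperm.subset h0
  · intro l₁ l₂ a b _
    refine ⟨sign k (parity p a) (parity p b), ?_⟩
    rw [Submodule.mem_bot, listEval_append, listEval_append, listEval_cons, listEval_cons,
      listEval_cons, listEval_cons, ← mul_assoc (ofLieWord k p a),
      mul_supercomm (ofLieWord_mem a) (ofLieWord_mem b), smul_mul_assoc, mul_smul_comm, mul_assoc,
      sub_self]
  · intro l₁ l₂ v _ hv
    rw [Submodule.mem_bot, listEval_append, listEval_cons, listEval_cons,
      ← mul_assoc (ofLieWord k p v), ofLieWord_mul_self hv, zero_mul, mul_zero]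

theorem listEval_mem_standardListSpan_of_list (hlt : IsAdmissibleOrder lt)
    (l : List (LieWord n)) : listEval k p l ∈ standardListSpan k p lt := by
  suffices H : ∀ l₁ : List (LieWord n), (∀ w ∈ l₁, w ∈ shternSet p lt) →
      listEval k p (l₁ ++ l) ∈ standardListSpan k p lt from
    H [] fun w hw => (List.not_mem_nil hw).elim
  induction l with
  | nil =>
    intro l₁ hl₁
    rw [List.append_nil]
    exact listEval_mem_standardListSpan hl₁
  | cons u l ih =>
    intro l₁ hl₁
    rw [listEval_append, listEval_cons]
    have hu := (isSuperLieEval_ofLieWord (k := k) (p := p)).mem_shternSpan hlt u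
    have hle : shternSpan p lt k (ofLieWord k p) u.length ≤ (standardListSpan k p lt).comap
        (LinearMap.mulLeft k (listEval k p l₁) ∘ₗ LinearMap.mulRight k (listEval k p l)) := by
      rw [shternSpan, Submodule.span_le]
      rintro _ ⟨w, ⟨hw, -⟩, rfl⟩
      have := ih (l₁ ++ [w]) (by
        intro z hz
        rcases List.mem_append.1 hz with hz | hz
        · exact hl₁ z hz
        · rw [List.mem_singleton.1 hz]
          exact hw)
      rwa [List.append_assoc, List.singleton_append, listEval_append, listEval_cons] at this
    exact hle hu

theorem standardListSpan_eq_top (hlt : IsAdmissibleOrder lt) : standardListSpan k p lt = ⊤ := by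
  rw [eq_top_iff, ← listSpan_eq_top, listSpan, Submodule.span_le]
  rintro _ ⟨l, rfl⟩
  exact listEval_mem_standardListSpan_of_list hlt l

/-! ### Formal monomials correspond to standard lists without the letter `1` -/

omit [CharZero k]

/-- The list of words, with repetitions, described by a formal monomial. -/
def expand (l : List (LieWord n × ℕ)) : List (LieWord n) :=
  l.flatMap fun q => List.replicate q.2 q.1

theorem expand_cons (q : LieWord n × ℕ) (l : List (LieWord n × ℕ)) :
    expand (q :: l) = List.replicate q.2 q.1 ++ expand l := by
  simp [expand]

theorem mem_expand {l : List (LieWord n × ℕ)} {w : LieWord n} (h : w ∈ expand l) :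
    ∃ q ∈ l, q.1 = w := by
  obtain ⟨q, hq, hw⟩ := List.mem_flatMap.1 h
  exact ⟨q, hq, (List.eq_of_mem_replicate hw).symm⟩

theorem listEval_expand (l : List (LieWord n × ℕ)) :
    listEval k p (expand l) = ofMonomial k p l := by
  induction l with
  | nil => rfl
  | cons q l ih =>
    rw [expand_cons, listEval_append, ih, listEval, List.map_replicate, List.prod_replicate,
      ofMonomial, ofMonomial, List.map_cons, List.prod_cons]

theorem tail_mem_monomials {q : LieWord n × ℕ} {l : List (LieWord n × ℕ)}
    (h : q :: l ∈ monomials p lt) : l ∈ monomials p lt :=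
  ⟨(List.pairwise_cons.1 h.1).2, fun r hr => h.2 r (List.mem_cons_of_mem _ hr)⟩

theorem head_notMem_expand {q : LieWord n × ℕ} {l : List (LieWord n × ℕ)}
    (h : q :: l ∈ monomials p lt) : q.1 ∉ expand l := by
  intro hq
  obtain ⟨r, hr, e⟩ := mem_expand hq
  have := (List.pairwise_cons.1 h.1).1 r hr
  rw [e] at this
  exact degLexLT_irrefl _ this

theorem isStandard_expand {l : List (LieWord n × ℕ)} (h : l ∈ monomials p lt) :
    IsStandard p lt (expand l) ∧ FreeMagma.of 0 ∉ expand l := by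
  refine ⟨⟨?_, ?_⟩, ?_⟩
  · induction l with
    | nil => exact List.Pairwise.nil
    | cons q l ih =>
      rw [expand_cons, List.pairwise_append]
      refine ⟨?_, ih (tail_mem_monomials h), ?_⟩
      · rw [List.pairwise_replicate]
        rcases ZMod.two_eq_zero_or_one (parity p q.1) with h0 | h1
        · exact Or.inr (Or.inr ⟨rfl, h0⟩)
        · exact Or.inl ((h.2 q List.mem_cons_self).2.2.2 h1).le
      · intro a ha b hb
        obtain ⟨r, hr, rfl⟩ := mem_expand hb
        rw [List.eq_of_mem_replicate ha]
        exact Or.inl ((List.pairwise_cons.1 h.1).1 r hr)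
  · intro w hw
    obtain ⟨q, hq, rfl⟩ := mem_expand hw
    exact (h.2 q hq).1
  · intro hw
    obtain ⟨q, hq, e⟩ := mem_expand hw
    exact (h.2 q hq).2.1 e

open Classical in
-- The first word of the expansion is the base of the first pair. That word does not recur in later
-- pairs, so its multiplicity is the exponent.
theorem expand_injOn : Set.InjOn expand (monomials p lt) := by
  intro l
  induction l with
  | nil =>
    rintro - l' hl' e
    cases l' with
    | nil => rfl
    | cons q l' =>
      rw [expand_cons] at e
      have := (List.append_eq_nil_iff.1 e.symm).1
      exact ((hl'.2 q List.mem_cons_self).2.2.1 (by simpa using this)).elim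
  | cons q l ih =>
    intro hl l' hl' e
    have hq := (hl.2 q List.mem_cons_self).2.2.1
    cases l' with
    | nil =>
      rw [expand_cons] at e
      have := (List.append_eq_nil_iff.1 e).1
      exact (hq (by simpa using this)).elim
    | cons r l' =>
      have hr := (hl'.2 r List.mem_cons_self).2.2.1
      rw [expand_cons, expand_cons] at e
      have hfst : q.1 = r.1 := by
        obtain ⟨a, ha⟩ := Nat.exists_eq_succ_of_ne_zero hq
        obtain ⟨b, hb⟩ := Nat.exists_eq_succ_of_ne_zero hr
        rw [ha, hb, List.replicate_succ, List.replicate_succ] at e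
        exact (List.cons.inj e).1
      have hsnd : q.2 = r.2 := by
        have hc := congrArg (List.count q.1) e
        rw [List.count_append, List.count_append, List.count_replicate_self,
          List.count_eq_zero.2 (head_notMem_expand hl), hfst, List.count_replicate_self,
          List.count_eq_zero.2 (head_notMem_expand hl')] at hc
        simpa using hc
      have hqr : q = r := Prod.ext hfst hsnd
      subst hqr
      rw [ih (tail_mem_monomials hl) (tail_mem_monomials hl') (List.append_cancel_left e)]

theorem exists_expand_eq {s : List (LieWord n)} (hs : IsStandard p lt s)
    (h0 : FreeMagma.of 0 ∉ s) : ∃ l ∈ monomials p lt, expand l = s := by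
  induction s with
  | nil => exact ⟨[], ⟨List.Pairwise.nil, fun q hq => (List.not_mem_nil hq).elim⟩, rfl⟩
  | cons w s ih =>
    obtain ⟨hs₁, hs₂⟩ := hs
    obtain ⟨hw, hs₁⟩ := List.pairwise_cons.1 hs₁
    obtain ⟨hw0, h0⟩ := not_or.1 (fun h => h0 (List.mem_cons.2 h))
    obtain ⟨l, hl, rfl⟩ := ih ⟨hs₁, fun z hz => hs₂ z (List.mem_cons_of_mem _ hz)⟩ h0
    have hwM := hs₂ w List.mem_cons_self
    have mem_of_mem : ∀ q ∈ l, q.1 ∈ expand l := by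
      intro q hq
      refine List.mem_flatMap.2 ⟨q, hq, ?_⟩
      rw [List.mem_replicate]
      exact ⟨(hl.2 q hq).2.2.1, rfl⟩
    by_cases hwl : w ∈ expand l
    · have heven : parity p w = 0 := by
        rcases hw w hwl with h | h
        · exact (degLexLT_irrefl _ h).elim
        · exact h.2
      cases l with
      | nil => exact (List.not_mem_nil hwl).elim
      | cons q l =>
        -- As w precedes everything in the sorted tail and already occurs there, it must be the
        -- first base, and its exponent is raised by one.
        have hqw : w = q.1 := by
          rcases hw q.1 (mem_of_mem q List.mem_cons_self) with h | h
          · obtain ⟨r, hr, e⟩ := mem_expand hwl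
            rcases List.mem_cons.1 hr with rfl | hr
            · exact e.symm
            · have := (List.pairwise_cons.1 hl.1).1 r hr
              rw [e] at this
              exact (degLexLT_irrefl _ (degLexLT_trans h this)).elim
          · exact h.1
        refine ⟨(w, q.2 + 1) :: l, ⟨List.pairwise_cons.2 ⟨?_, (List.pairwise_cons.1 hl.1).2⟩, ?_⟩,
          ?_⟩
        · intro r hr
          rw [hqw]
          exact (List.pairwise_cons.1 hl.1).1 r hr
        · intro r hr
          rcases List.mem_cons.1 hr with rfl | hr
          · refine ⟨hwM, fun h => hw0 h.symm, Nat.succ_ne_zero _, fun h => ?_⟩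
            rw [heven] at h
            exact (zero_ne_one h).elim
          · exact hl.2 r (List.mem_cons_of_mem _ hr)
        · rw [expand_cons, expand_cons, List.replicate_succ, List.cons_append, hqw]
    · refine ⟨(w, 1) :: l, ⟨List.pairwise_cons.2 ⟨?_, hl.1⟩, ?_⟩, ?_⟩
      · intro q hq
        have hmem := mem_of_mem q hq
        rcases hw q.1 hmem with h | h
        · exact h
        · exact (hwl (h.1 ▸ hmem)).elim
      · intro r hr
        rcases List.mem_cons.1 hr with rfl | hr
        · exact ⟨hwM, fun h => hw0 h.symm, one_ne_zero, fun _ => rfl⟩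
        · exact hl.2 r hr
      · rw [expand_cons, List.replicate_one, List.singleton_append]

end GenP

theorem mainTheorem1 (k : Type*) [Field k] [CharZero k] (n : ℕ) (p : Fin n → ZMod 2)
    (lt : LieWord n → LieWord n → Prop) (hlt : LieWord.IsAdmissibleOrder lt) :
    LinearIndependent k (fun l : GenP.monomials p lt => GenP.ofMonomial k p l.1) ∧
      Submodule.span k (Set.range (fun l : GenP.monomials p lt => GenP.ofMonomial k p l.1)) =
        (⊤ : Submodule k (GenP k p)) := by
  constructor
  · have h := (LieWord.linearIndependent_listToDiWord (k := k) (p := p) hlt).comp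
      (fun l : GenP.monomials p lt => ⟨GenP.expand l.1, GenP.isStandard_expand l.2⟩)
      fun l l' e => Subtype.ext (GenP.expand_injOn l.2 l'.2 (Subtype.mk.inj e))
    convert h using 2 with l
    rw [Function.comp_apply, GenP.mk_word_listToDiWord, GenP.listEval_expand]
  · rw [eq_top_iff, ← GenP.standardListSpan_eq_top hlt]
    refine Submodule.span_mono ?_
    rintro _ ⟨s, ⟨hs, h0⟩, rfl⟩
    obtain ⟨l, hl, rfl⟩ := GenP.exists_expand_eq hs h0
    exact ⟨⟨l, hl⟩, (GenP.listEval_expand l).symm⟩
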